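/- Let $S$ be a Dedekind scheme, i.e. an integral Noetherian normal scheme of dimension at most $1$ (not necessarily excellent), with field of rational functions $K$. By an algebraic group over $K$ we mean a commutative group scheme of finite type over $K$. A Néron model over $S$ of an algebraic group $H$ over $K$ is a smooth, separated, quasi-compact $S$-group scheme $\mathscr{H}$ with generic fibre $H$ such that, for every smooth morphism $T\to S$, each $K$-morphism $T\times_S \operatorname{Spec} K\to H$ extends uniquely to an $S$-morphism $T\to\mathscr{H}$. For a closed point $s\in S$, let $K_s^{\mathrm{sh}}$ be a maximal extension of $K$ unramified at $s$. That is, $K_s^{\mathrm{sh}}$ is a separable algebraic extension of $K$ together with a valuation ring $A_s$ of $K_s^{\mathrm{sh}}$ such that $A_s\cap K=\mathcal{O}_{S,s}$, such that the maximal ideal of $\mathcal{O}_{S,s}$ generates that of $A_s$, and such that the extension of residue fields is separable algebraic; and it is maximal among such valued extensions of $K$ (equivalently, $A_s$ is a strict Henselization of $\mathcal{O}_{S,s}$ and $K_s^{\mathrm{sh}}$ is its fraction field). Let $\widehat{K}_s^{\mathrm{sh}}$ be the completion of $K_s^{\mathrm{sh}}$ with respect to the valuation defined by $A_s$. Theorem.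 Let $f\colon G\to H$ be a smooth surjective homomorphism of algebraic groups over $K$, and assume that $H$ admits a Néron model over $S$. Then, for all but finitely many closed points $s$ of $S$, the maps $f(K_s^{\mathrm{sh}})\colon G(K_s^{\mathrm{sh}})\to H(K_s^{\mathrm{sh}})$ and $f(\widehat{K}_s^{\mathrm{sh}})\colon G(\widehat{K}_s^{\mathrm{sh}})\to H(\widehat{K}_s^{\mathrm{sh}})$ are surjective (for every choice of $K_s^{\mathrm{sh}}$). -/

import Mathlib

open AlgebraicGeometry CategoryTheory Limits

universe u

/-- A Dedekind scheme with a field of rational functions: an integral Noetherian normal scheme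
of dimension at most one. Neither excellence nor separatedness is required. -/
class IsDedekindScheme (S : Scheme.{u}) : Prop where
  isIntegral : IsIntegral S
  isNoetherian : IsNoetherian S
  isIntegrallyClosed_stalk (s : S) : IsIntegrallyClosed (S.presheaf.stalk s)
  krullDim_le_one : topologicalKrullDim S ≤ 1

attribute [instance] IsDedekindScheme.isIntegral IsDedekindScheme.isNoetherian

/-! ### Algebraic groups and their rational points -/

/-- A commutative group scheme of finite type over (the spectrum of) `K`. -/
class IsAlgebraicGroup {K : CommRingCat.{u}} (G : Over (Spec K)) [GrpObj G] : Prop where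
  isCommMonObj : IsCommMonObj G
  locallyOfFiniteType : LocallyOfFiniteType G.hom
  quasiCompact : QuasiCompact G.hom

/-- The set `X(E)` of `E`-valued points of a `K`-scheme `X`, for a ring map `φ : K → E`. -/
noncomputable abbrev RationalPoints {K : CommRingCat.{u}} (X : Over (Spec K)) {E : Type u} [CommRing E]
    (φ : K →+* E) : Type u :=
  Over.mk (Spec.map (CommRingCat.ofHom φ)) ⟶ X

/-- The map `f(E) : X(E) → Y(E)`. -/
noncomputable def RationalPoints.map {K : CommRingCat.{u}} {X Y : Over (Spec K)} (f : X ⟶ Y) {E : Type u}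
    [CommRing E] (φ : K →+* E) (x : RationalPoints X φ) : RationalPoints Y φ :=
  x ≫ f

/-! ### Néron models -/

/-- The functor sending an `S`-scheme `T` to its generic fibre `T ×_S Spec K`, where `K` is the
field of rational functions of `S`. -/
noncomputable abbrev genericFibre (S : Scheme.{u}) [IsIntegral S] :
    Over S ⥤ Over (Spec S.functionField) :=
  Over.pullback (S.fromSpecStalk (genericPoint S))

/-- The `S`-group scheme `N`, whose generic fibre is identified with the `K`-group scheme `H`
via `e`, is a Néron model of `H`. -/
structure IsNeronModel {S : Scheme.{u}} [IsIntegral S] (H : Over (Spec S.functionField))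
    [GrpObj H] (N : Over S) [GrpObj N] (e : (genericFibre S).obj N ≅ H) : Prop where
  smooth : Smooth N.hom
  isSeparated : IsSeparated N.hom
  quasiCompact : QuasiCompact N.hom
  /-- The identification of the generic fibre respects the group structures. -/
  isMonHom :
    letI : GrpObj ((genericFibre S).obj N) := Functor.grpObjObj
    IsMonHom e.hom
  /-- The Néron mapping property. -/
  existsUnique_extension (T : Over S) (_ : Smooth T.hom) (φ : (genericFibre S).obj T ⟶ H) :
    ∃! ψ : T ⟶ N, (genericFibre S).map ψ ≫ e.hom = φ

/-- The `K`-group scheme `H` admits a Néron model over `S`. -/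
def HasNeronModel {S : Scheme.{u}} [IsIntegral S] (H : Over (Spec S.functionField))
    [GrpObj H] : Prop :=
  ∃ (N : Over S) (_ : GrpObj N) (e : (genericFibre S).obj N ≅ H), IsNeronModel H N e

/-! ### Maximal unramified extensions -/

section Unramified

variable (R K : Type u) [CommRing R] [Field K] [Algebra R K]

/-- For a ring `R` with fraction field `K` and an extension `L` of `K`, the valuation ring
`A` of `L` extends `R`, i.e. `A ∩ K = R`. -/
def ExtendsRing {L : Type u} [Field L] [Algebra K L] (A : ValuationSubring L) : Prop :=
  ∀ x : K, algebraMap K L x ∈ A ↔ x ∈ (algebraMap R K).range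

variable {R K}

namespace ExtendsRing

variable {L : Type u} [Field L] [Algebra K L] {A : ValuationSubring L}

/-- The inclusion `R → A`. -/
def ringHom (h : ExtendsRing R K A) : R →+* A :=
  ((algebraMap K L).comp (algebraMap R K)).codRestrict A.toSubring
    fun r => (h (algebraMap R K r)).2 ⟨r, rfl⟩

variable [IsFractionRing R K]

theorem isLocalHom_ringHom (h : ExtendsRing R K A) : IsLocalHom h.ringHom where
  map_nonunit r hr := by
    obtain ⟨b, hb⟩ := hr.exists_right_inv
    have hb' : algebraMap K L (algebraMap R K r) * (b : L) = 1 := congrArg Subtype.val hb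
    have hr0 : algebraMap K L (algebraMap R K r) ≠ 0 := left_ne_zero_of_mul_eq_one hb'
    have hr1 : algebraMap R K r ≠ 0 := fun h0 => hr0 (by rw [h0, map_zero])
    have hbK : algebraMap K L (algebraMap R K r)⁻¹ = (b : L) := by
      rw [map_inv₀]
      exact inv_eq_of_mul_eq_one_right hb'
    obtain ⟨c, hc⟩ := (h (algebraMap R K r)⁻¹).1 (hbK ▸ b.2)
    refine IsUnit.of_mul_eq_one c (IsFractionRing.injective R K ?_)
    rw [map_mul, hc, map_one, mul_inv_cancel₀ hr1]

variable [IsLocalRing R]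

/-- The induced map from the residue field of `R` to that of `A`. -/
noncomputable def residueFieldMap (h : ExtendsRing R K A) :
    IsLocalRing.ResidueField R →+* IsLocalRing.ResidueField A :=
  haveI := h.isLocalHom_ringHom
  IsLocalRing.ResidueField.map h.ringHom

end ExtendsRing

variable (R K) [IsLocalRing R] [IsFractionRing R K]

/-- The (possibly infinite) separable algebraic extension `L` of `K`, equipped with the valuation
ring `A` extending `R`, is unramified over `R`: the maximal ideal of `R` generates that of `A`, and
the extension of residue fields is separable. -/
structure IsUnramifiedExtension {L : Type u} [Field L] [Algebra K L]
    (A : ValuationSubring L) : Prop where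
  isSeparable : Algebra.IsSeparable K L
  extendsRing : ExtendsRing R K A
  map_maximalIdeal :
    (IsLocalRing.maximalIdeal R).map extendsRing.ringHom = IsLocalRing.maximalIdeal A
  isSeparable_residueField :
    letI := extendsRing.residueFieldMap.toAlgebra
    Algebra.IsSeparable (IsLocalRing.ResidueField R) (IsLocalRing.ResidueField A)

/-- `(L, A)` is a maximal unramified extension of `K` with respect to `R`: it is unramified, and no
unramified extension `(L', A')` with `A' ∩ L = A` is strictly larger. -/
structure IsMaximalUnramifiedExtension {L : Type u} [Field L] [Algebra K L]
    (A : ValuationSubring L) : Prop extends IsUnramifiedExtension R K A where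
  maximal (L' : Type u) [Field L'] [Algebra K L'] [Algebra L L'] [IsScalarTower K L L']
    (A' : ValuationSubring L') (_ : A'.comap (algebraMap L L') = A)
    (_ : IsUnramifiedExtension R K A') : Function.Surjective (algebraMap L L')

end Unramified

/-- The completion of `L` with respect to the valuation with valuation ring `A`. -/
abbrev ValuationSubring.FieldCompletion {L : Type u} [Field L] (A : ValuationSubring L) : Type u :=
  A.valuation.Completion

/-- The embedding of `L` into its completion. -/
noncomputable def ValuationSubring.toFieldCompletion {L : Type u} [Field L]
    (A : ValuationSubring L) : L →+* A.FieldCompletion :=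
  (UniformSpace.Completion.coeRingHom (α := WithVal A.valuation)).comp
    (WithVal.equiv A.valuation).symm.toRingHom

/-! ### Unramified extensions of discrete valuation rings -/

section MaximalUnramified

open IsLocalRing

variable {R K : Type u} [CommRing R] [Field K] [Algebra R K] [IsDomain R]
  [IsDiscreteValuationRing R] [IsFractionRing R K]
  {L : Type u} [Field L] [Algebra K L] {A : ValuationSubring L}

/-! Let `N` be the Néron model of `H`. Every point of `H` is the image of a point of `G`, hence lies
in the image of a smooth affine chart of `G`. Clearing denominators spreads such a chart out to a
smooth morphism `q : Spec Z ⟶ N` with the property that a point of `Z` whose image in `N` comes from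
`H` lifts to `G` (`Smooth.exists_spreading_out`). The images of these `q` are open and together
cover the generic fibre of `N`. The complement of their union has finitely many irreducible
components, and the generic point of each lies over a closed point of `S`; so the complement lies
over finitely many closed points (`IsNeronModel.finite_setOf_not_lift`).

Let `s` be any other non-generic point and `x` a point of `H` over `L`, the maximal unramified
extension with valuation ring `A`. Then `x` is defined over a finite subextension of `L`, which is
the generic fibre of an étale algebra mapping to `A`. The Néron property extends `x` over that
algebra, hence to a morphism from `Spec A` to `N`
(`IsNeronModel.exists_point_of_isUnramifiedExtension`). Its closed point is in the image of some
`q`. Maximality of `L` makes `A` strictly Henselian, so the morphism lifts to `Z`, and `x` lifts to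
`G`.

For a point `h` over the completion, the group law is used. Since `H` is smooth and `L` is dense,
`h` can be approximated by an `L`-point `y` of `H`. The difference of `y` and `h` is then close to
the identity, which lifts to `G`; smoothness of `f` and Henselianity of the completion let this lift
deform to a lift of the difference. As `y` lifts by the first half, so does `h`
(`surjective_rationalPoints_of_denseRange`). That the approximation can be taken over `L` itself
rests on `L` being separably closed in its completion. -/

/-- An unramified extension of a discrete valuation ring is a discrete valuation ring. -/
theorem IsUnramifiedExtension.isDiscreteValuationRing (h : IsUnramifiedExtension R K A) :
    IsDiscreteValuationRing A := by
  have := h.isSeparable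
  obtain ⟨p, hp⟩ := IsDiscreteValuationRing.exists_irreducible R
  let := h.extendsRing.ringHom.toAlgebra
  let : Algebra R L := ((algebraMap K L).comp (algebraMap R K)).toAlgebra
  have : IsScalarTower R K L := .of_algebraMap_eq fun _ => rfl
  have : IsScalarTower R A L := .of_algebraMap_eq fun _ => rfl
  have hmax : maximalIdeal A = Ideal.span {algebraMap R A p} := by
    rw [← h.map_maximalIdeal, hp.maximalIdeal_eq, Ideal.map_span, Set.image_singleton]
    rfl
  have hinj : Function.Injective (algebraMap R A) := by
    refine .of_comp (f := algebraMap A L) ?_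
    rw [← RingHom.coe_comp, ← IsScalarTower.algebraMap_eq, IsScalarTower.algebraMap_eq R K L]
    exact (algebraMap K L).injective.comp (IsFractionRing.injective R K)
  have hp0 : algebraMap R A p ≠ 0 := (map_ne_zero_iff _ hinj).2 hp.ne_zero
  have hprime : Prime (algebraMap R A p) :=
    (Ideal.span_singleton_prime hp0).1 (hmax ▸ inferInstance)
  refine IsDiscreteValuationRing.ofHasUnitMulPowIrreducibleFactorization
    ⟨algebraMap R A p, hprime.irreducible, fun {x} hx => ?_⟩
  have halg : IsAlgebraic R x := by
    rw [← isAlgebraic_algebraMap_iff (A := L) (Subtype.val_injective),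
      IsFractionRing.isAlgebraic_iff R K L]
    exact Algebra.IsAlgebraic.isAlgebraic _
  -- Algebraicity over `R` makes `x` divide a nonzero element of `R`, hence a power of the
  -- uniformizer.
  obtain ⟨r, hr, hxr⟩ := halg.exists_nonzero_dvd (mem_nonZeroDivisors_of_ne_zero hx)
  obtain ⟨n, hn⟩ := IsDiscreteValuationRing.associated_pow_irreducible hr hp
  have : x ∣ algebraMap R A p ^ n := by
    rw [← map_pow]
    exact hxr.trans (map_dvd (algebraMap R A) hn.dvd)
  obtain ⟨i, -, hi⟩ := (dvd_prime_pow hprime n).1 this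
  exact ⟨i, hi.symm⟩

end MaximalUnramified

/-- A local homomorphism of valuation rings exhibits the source as the intersection of the target
with the smaller field. -/
theorem ValuationSubring.comap_eq_of_isLocalHom {L L' : Type*} [Field L] [Field L'] [Algebra L L']
    {A : ValuationSubring L} {A' : ValuationSubring L'} (g : A →+* A') [IsLocalHom g]
    (hg : ∀ a, (g a : L') = algebraMap L L' a) : A'.comap (algebraMap L L') = A := by
  ext x
  rw [ValuationSubring.mem_comap]
  refine ⟨fun hx => ?_, fun hx => hg ⟨x, hx⟩ ▸ (g ⟨x, hx⟩).2⟩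
  rcases A.mem_or_inv_mem x with hxA | hxA
  · exact hxA
  by_cases hx0 : x = 0
  · exact hx0 ▸ A.zero_mem
  have hu : IsUnit (g ⟨x⁻¹, hxA⟩) := by
    refine .of_mul_eq_one ⟨algebraMap L L' x, hx⟩ (Subtype.ext ?_)
    simp [hg, hx0]
  obtain ⟨b, hb⟩ := (isUnit_of_map_unit g _ hu).exists_right_inv
  have : x⁻¹ * (b : L) = 1 := congrArg Subtype.val hb
  rw [inv_mul_eq_one₀ hx0] at this
  exact this ▸ b.2

/-! ### Maximality expressed over `A` instead of `R` -/

section Maximality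

open IsLocalRing

variable {R K : Type u} [CommRing R] [Field K] [Algebra R K] [IsLocalRing R] [IsFractionRing R K]
  {L : Type u} [Field L] [Algebra K L] {A : ValuationSubring L}

/-- Maximality of `(L, A)` with respect to unramified extensions of `(L, A)`. -/
theorem IsMaximalUnramifiedExtension.algebraMap_surjective
    (h : IsMaximalUnramifiedExtension R K A)
    {L' : Type u} [Field L'] [Algebra L L'] [Algebra.IsSeparable L L'] (A' : ValuationSubring L')
    (g : A →+* A') [IsLocalHom g] (hg : ∀ a, (g a : L') = algebraMap L L' a)
    (hmax : (maximalIdeal A).map g = maximalIdeal A')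
    (hres : letI := (ResidueField.map g).toAlgebra
      Algebra.IsSeparable (ResidueField A) (ResidueField A')) :
    Function.Surjective (algebraMap L L') := by
  have hcomap := ValuationSubring.comap_eq_of_isLocalHom g hg
  let : Algebra K L' := ((algebraMap L L').comp (algebraMap K L)).toAlgebra
  have : IsScalarTower K L L' := .of_algebraMap_eq fun _ => rfl
  have hext : ExtendsRing R K A' := fun x => by
    rw [← h.extendsRing x, IsScalarTower.algebraMap_apply K L L', ← ValuationSubring.mem_comap,
      hcomap]
  have hcomp : g.comp h.extendsRing.ringHom = hext.ringHom := by
    ext x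
    exact hg _
  have := h.isSeparable
  refine h.maximal L' A' hcomap ⟨Algebra.IsSeparable.trans K L L', hext, ?_, ?_⟩
  · rw [← hcomp, ← Ideal.map_map, h.map_maximalIdeal, hmax]
  · let := h.extendsRing.residueFieldMap.toAlgebra
    let := (ResidueField.map g).toAlgebra
    let := hext.residueFieldMap.toAlgebra
    have : IsScalarTower (ResidueField R) (ResidueField A) (ResidueField A') := by
      refine .of_algebraMap_eq fun x => ?_
      obtain ⟨x, rfl⟩ := residue_surjective x
      exact congrArg (residue A') (congr($hcomp x)).symm
    have := h.isSeparable_residueField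
    exact Algebra.IsSeparable.trans (ResidueField R) (ResidueField A) (ResidueField A')

/-- Maximality of `(L, A)`, in terms of a valuation ring `D` dominating `A`. -/
theorem IsMaximalUnramifiedExtension.exists_algHom
    (h : IsMaximalUnramifiedExtension R K A)
    (D L' : Type u) [CommRing D] [IsDomain D] [ValuationRing D] [Algebra A D]
    [IsLocalHom (algebraMap A D)] [Field L'] [Algebra D L'] [IsFractionRing D L']
    [Algebra A L'] [IsScalarTower A D L'] [Algebra L L'] [IsScalarTower A L L']
    [Algebra.IsSeparable L L'] (hmax : (maximalIdeal A).map (algebraMap A D) = maximalIdeal D)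
    [Algebra.IsSeparable (ResidueField A) (ResidueField D)] :
    Nonempty (D →ₐ[A] A) := by
  -- The image of `D` in `L'` is a valuation subring unramified over `A`; maximality forces `L' =
  -- L`, and then `D = A`.
  let A' : ValuationSubring L' := ⟨(algebraMap D L').range, fun x => by
    rcases ValuationRing.isInteger_or_isInteger D x with h | h
    · exact .inl h
    · exact .inr h⟩
  let e : D ≃+* A' := RingEquiv.ofBijective (algebraMap D L').rangeRestrict
    ⟨fun x y hxy => IsFractionRing.injective D L' (congrArg Subtype.val hxy),
      (algebraMap D L').rangeRestrict_surjective⟩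
  let g : A →+* A' := (e : D →+* A').comp (algebraMap A D)
  have : IsLocalHom g := inferInstance
  have hg (a : A) : (g a : L') = algebraMap L L' a :=
    (IsScalarTower.algebraMap_apply A D L' a).symm.trans (IsScalarTower.algebraMap_apply A L L' a)
  have hsurj : Function.Surjective (algebraMap L L') := by
    refine h.algebraMap_surjective A' g hg ?_ ?_
    · rw [← Ideal.map_map, hmax]
      ext x
      obtain ⟨x, rfl⟩ := e.surjective x
      rw [Ideal.map_comap_of_equiv]
      simp
    · let := (ResidueField.map g).toAlgebra
      exact AlgEquiv.Algebra.isSeparable (F := ResidueField A) (K := ResidueField D)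
        (E := ResidueField A') (.ofRingEquiv (f := ResidueField.mapEquiv e) fun x => by
          obtain ⟨x, rfl⟩ := residue_surjective x
          rfl)
  have hbij : Function.Bijective (algebraMap A D) := by
    refine ⟨.of_comp (f := algebraMap D L') ?_, fun d => ?_⟩
    · rw [← RingHom.coe_comp, ← IsScalarTower.algebraMap_eq, IsScalarTower.algebraMap_eq A L L']
      exact (algebraMap L L').injective.comp Subtype.val_injective
    · obtain ⟨y, hy⟩ := hsurj (algebraMap D L' d)
      have hyA : y ∈ A := by
        rw [← ValuationSubring.comap_eq_of_isLocalHom g hg, ValuationSubring.mem_comap, hy]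
        exact ⟨d, rfl⟩
      refine ⟨⟨y, hyA⟩, IsFractionRing.injective D L' ?_⟩
      rw [← hy, ← IsScalarTower.algebraMap_apply, IsScalarTower.algebraMap_apply A L L']
      rfl
  exact ⟨(AlgEquiv.ofBijective (Algebra.ofId A D) hbij).symm⟩

end Maximality

/-- A flat Noetherian local algebra over a discrete valuation ring whose maximal ideal is generated
by that of the base is a discrete valuation ring. -/
theorem IsDiscreteValuationRing.of_flat_of_map_maximalIdeal (A D : Type u) [CommRing A] [IsDomain A]
    [IsDiscreteValuationRing A] [CommRing D] [IsLocalRing D] [IsNoetherianRing D] [Algebra A D]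
    [Module.Flat A D] (hmax : (IsLocalRing.maximalIdeal A).map (algebraMap A D) =
      IsLocalRing.maximalIdeal D) :
    ∃ _ : IsDomain D, IsDiscreteValuationRing D := by
  obtain ⟨p, hp⟩ := IsDiscreteValuationRing.exists_irreducible A
  set π := algebraMap A D p with hπ
  have hm : IsLocalRing.maximalIdeal D = Ideal.span {π} := by
    rw [← hmax, hp.maximalIdeal_eq, Ideal.map_span, Set.image_singleton]
  have hreg (n : ℕ) (x : D) (hx : π ^ n * x = 0) : x = 0 := by
    have := Module.Flat.isSMulRegular_of_isRegular (M := D)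
      (IsRegular.of_ne_zero (pow_ne_zero n hp.ne_zero))
    refine this ?_
    simpa [Algebra.smul_def] using hx
  have hfac {x : D} (hx : x ≠ 0) : ∃ n : ℕ, ∃ y, IsUnit y ∧ x = π ^ n * y := by
    -- Krull's intersection theorem: a nonzero element has finite order along `π`.
    have hx' : ∃ n, x ∉ IsLocalRing.maximalIdeal D ^ n := by
      by_contra! hcon
      refine hx ?_
      have := Ideal.iInf_pow_eq_bot_of_isLocalRing (IsLocalRing.maximalIdeal D)
        Ideal.IsPrime.ne_top'
      rw [← Ideal.mem_bot, ← this]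
      simpa using hcon
    classical
    obtain ⟨n, hn⟩ : ∃ n, Nat.find hx' = n + 1 := Nat.exists_eq_succ_of_ne_zero fun h0 =>
      Nat.find_spec hx' (by simp [h0])
    have h1 : x ∈ IsLocalRing.maximalIdeal D ^ n := not_not.1 (Nat.find_min hx' (by omega))
    have h2 : x ∉ IsLocalRing.maximalIdeal D ^ (n + 1) := hn ▸ Nat.find_spec hx'
    rw [hm, Ideal.span_singleton_pow, Ideal.mem_span_singleton] at h1 h2
    obtain ⟨y, rfl⟩ := h1
    refine ⟨n, y, ?_, rfl⟩
    by_contra hy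
    rw [← mem_nonunits_iff, ← IsLocalRing.mem_maximalIdeal, hm, Ideal.mem_span_singleton] at hy
    exact h2 (pow_succ π n ▸ mul_dvd_mul_left _ hy)
  have hdom : IsDomain D := by
    have : NoZeroDivisors D := ⟨fun {x y} hxy => by
      by_contra! hne
      obtain ⟨n, u, hu, rfl⟩ := hfac hne.1
      obtain ⟨m, v, hv, rfl⟩ := hfac hne.2
      refine (hu.mul hv).ne_zero (hreg (n + m) _ ?_)
      rw [← hxy]
      ring⟩
    exact NoZeroDivisors.to_isDomain D
  refine ⟨hdom, IsDiscreteValuationRing.ofHasUnitMulPowIrreducibleFactorization ⟨π, ?_, ?_⟩⟩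
  · have hπ0 : π ≠ 0 := fun h0 => one_ne_zero (hreg 1 1 (by simp [h0]))
    exact ((Ideal.span_singleton_prime hπ0).1 (hm ▸ inferInstance)).irreducible
  · intro x hx
    obtain ⟨n, y, hy, rfl⟩ := hfac hx
    exact ⟨n, associated_mul_unit_right _ _ hy⟩

/-- Two primes with the same contraction to the base are the contractions of a prime of the tensor
product. -/
theorem Ideal.exists_isPrime_tensorProduct {B A C : Type*} [CommRing B] [CommRing A] [CommRing C]
    [Algebra B A] [Algebra B C] (p : Ideal A) [p.IsPrime] (q : Ideal C) [q.IsPrime]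
    (h : p.comap (algebraMap B A) = q.comap (algebraMap B C)) :
    ∃ P : Ideal (TensorProduct B A C), P.IsPrime ∧ P.LiesOver p := by
  let r := p.comap (algebraMap B A)
  let _ := (Ideal.ResidueField.map r p (algebraMap B A) rfl).toAlgebra
  let _ := (Ideal.ResidueField.map r q (algebraMap B C) h).toAlgebra
  let T := TensorProduct r.ResidueField p.ResidueField q.ResidueField
  have : IsScalarTower B r.ResidueField p.ResidueField := .of_algebraMap_eq fun x => by
    rw [RingHom.algebraMap_toAlgebra, Ideal.ResidueField.map_algebraMap,
      ← IsScalarTower.algebraMap_apply]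
  have : IsScalarTower B r.ResidueField q.ResidueField := .of_algebraMap_eq fun x => by
    rw [RingHom.algebraMap_toAlgebra, Ideal.ResidueField.map_algebraMap,
      ← IsScalarTower.algebraMap_apply]
  -- A tensor product of two extensions of a field is nonzero; the kernel of the map to one of its
  -- residue fields is the prime sought.
  obtain ⟨m, hm⟩ := Ideal.exists_maximal T
  let i : A →ₐ[B] T ⧸ m := ((Ideal.Quotient.mkₐ r.ResidueField m).comp
    Algebra.TensorProduct.includeLeft).restrictScalars B |>.comp
      (IsScalarTower.toAlgHom B A p.ResidueField)
  let j : C →ₐ[B] T ⧸ m := ((Ideal.Quotient.mkₐ r.ResidueField m).comp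
    Algebra.TensorProduct.includeRight).restrictScalars B |>.comp
      (IsScalarTower.toAlgHom B C q.ResidueField)
  let φ := Algebra.TensorProduct.lift i j fun _ _ => .all _ _
  refine ⟨RingHom.ker φ, RingHom.ker_isPrime φ, ⟨?_⟩⟩
  let _ := Ideal.Quotient.field m
  ext x
  rw [Ideal.under_def, Ideal.mem_comap, RingHom.mem_ker]
  have : φ (algebraMap A _ x) = (Ideal.Quotient.mk m).comp
      (Algebra.TensorProduct.includeLeftRingHom) (algebraMap A p.ResidueField x) := by
    simp [φ, Algebra.TensorProduct.algebraMap_apply, i]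
    rfl
  rw [this, map_eq_zero_iff _ (RingHom.injective _), Ideal.algebraMap_residueField_eq_zero]

/-! ### Strict Henselianity of `A` -/

section Sections

open IsLocalRing

variable {R K : Type u} [CommRing R] [Field K] [Algebra R K] [IsDomain R]
  [IsDiscreteValuationRing R] [IsFractionRing R K]
  {L : Type u} [Field L] [Algebra K L] {A : ValuationSubring L}

/-- `A` is strictly Henselian: étale `A`-algebras with non-empty special fibre have a section. -/
theorem IsMaximalUnramifiedExtension.exists_algHom_of_etale
    (h : IsMaximalUnramifiedExtension R K A) (E : Type u) [CommRing E] [Algebra A E]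
    [Algebra.Etale A E] (q : Ideal E) [q.IsPrime] [q.LiesOver (maximalIdeal A)] :
    Nonempty (E →ₐ[A] A) := by
  have := h.toIsUnramifiedExtension.isDiscreteValuationRing
  let D := Localization.AtPrime q
  have : IsLocalHom (algebraMap A D) := by
    refine ((local_hom_TFAE _).out 0 4).2 ?_
    rw [IsScalarTower.algebraMap_eq A E D, ← Ideal.comap_comap,
      show (maximalIdeal D).comap (algebraMap E D) = q from Localization.AtPrime.under_maximalIdeal]
    exact (q.over_def (maximalIdeal A)).symm
  have : Algebra.EssFiniteType A D := .comp A E D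
  have : Algebra.FormallyEtale A D := inferInstance
  have hmax := Algebra.FormallyUnramified.map_maximalIdeal (R := A) (S := D)
  have : IsNoetherianRing E := Algebra.FiniteType.isNoetherianRing A E
  have : IsNoetherianRing D := IsLocalization.isNoetherianRing q.primeCompl D inferInstance
  have : Module.Flat A D := .trans A E D
  -- The local ring of an étale algebra is thus a discrete valuation ring unramified over `A`, with
  -- fraction field separable over `L`.
  obtain ⟨_, _⟩ := IsDiscreteValuationRing.of_flat_of_map_maximalIdeal A D hmax
  let L' := FractionRing D
  have hinj : Function.Injective (algebraMap A L') := by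
    rw [IsScalarTower.algebraMap_eq A D L', RingHom.coe_comp]
    exact (IsFractionRing.injective D L').comp (FaithfulSMul.algebraMap_injective A D)
  let : Algebra L L' := (IsFractionRing.lift hinj).toAlgebra
  have : IsScalarTower A L L' := 
    .of_algebraMap_eq fun x => (IsFractionRing.lift_algebraMap hinj x).symm
  have : Algebra.FormallyEtale D L' := .of_isLocalization (nonZeroDivisors D)
  have : Algebra.FormallyEtale A L' := .comp A D L'
  have : Algebra.FormallyEtale L L' := .localization_base (nonZeroDivisors A)
  have : Algebra.EssFiniteType D L' := .of_isLocalization _ (nonZeroDivisors D)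
  have : Algebra.EssFiniteType A L' := .comp A D L'
  have : Algebra.EssFiniteType L L' := .of_comp A L L'
  have : Algebra.IsSeparable L L' := Algebra.FormallyUnramified.isSeparable L L'
  obtain ⟨σ⟩ := h.exists_algHom D L' hmax
  exact ⟨σ.comp (IsScalarTower.toAlgHom A E D)⟩

-- Over a residue field with `Q` elements, `X ^ Q - X - 1` is separable and takes only the value
-- `-1`. It would define an étale algebra with nonempty special fibre and no section. Infinitude is
-- what later provides rational points in nonempty open subsets of affine space.
open Polynomial in
theorem IsMaximalUnramifiedExtension.infinite_residueField
    (h : IsMaximalUnramifiedExtension R K A) : Infinite (ResidueField A) := by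
  by_contra hfin
  rw [not_infinite_iff_finite] at hfin
  let _ := Fintype.ofFinite (ResidueField A)
  set Q := Fintype.card (ResidueField A) with hQ
  have hQ1 : 1 < Q := Fintype.one_lt_card
  have hcast : (Q : ResidueField A) = 0 := FiniteField.cast_card_eq_zero _
  have hdeg {B : Type u} [CommRing B] [Nontrivial B] : (X + 1 : B[X]).degree < Q := by
    rw [← map_one C, degree_X_add_C]
    exact_mod_cast hQ1
  let f : A[X] := X ^ Q - (X + 1)
  have hf : f.Monic := monic_X_pow_sub hdeg
  let P : StandardEtalePair A := ⟨f, hf, f.derivative, 1, 0, 1, by simp⟩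
  let Ω := AlgebraicClosure (ResidueField A)
  obtain ⟨x, hx⟩ : ∃ x : Ω, aeval x f = 0 := by
    have : (f.map (algebraMap A Ω)).degree ≠ 0 := by
      rw [hf.degree_map, degree_sub_eq_left_of_degree_lt (by simpa using hdeg), degree_X_pow]
      exact_mod_cast (by omega : Q ≠ 0)
    obtain ⟨x, hx⟩ := IsAlgClosed.exists_root _ this
    exact ⟨x, by rwa [IsRoot, eval_map_algebraMap] at hx⟩
  have hP : P.HasMap x := by
    refine ⟨hx, ?_⟩
    have : (Q : Ω) = 0 := by simpa using congrArg (algebraMap (ResidueField A) Ω) hcast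
    simp [P, f, derivative_X_pow, this]
  let φ := P.lift x hP
  have : (RingHom.ker φ).IsPrime := RingHom.ker_isPrime φ
  have : (RingHom.ker φ).LiesOver (maximalIdeal A) := ⟨by
    ext y
    rw [Ideal.under_def, Ideal.mem_comap, RingHom.mem_ker, AlgHom.commutes,
      IsScalarTower.algebraMap_apply A (ResidueField A) Ω, map_eq_zero_iff _ (RingHom.injective _),
      ResidueField.algebraMap_eq, residue_eq_zero_iff]⟩
  obtain ⟨σ⟩ := h.exists_algHom_of_etale P.Ring (RingHom.ker φ)
  have h2 := congrArg (residue A) (P.hasMap_X.map σ).1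
  simp [P, f, hQ, FiniteField.pow_card] at h2

/-- `A` is strictly Henselian: smooth `A`-algebras with non-empty special fibre have a section. -/
theorem IsMaximalUnramifiedExtension.exists_algHom_of_smooth
    (h : IsMaximalUnramifiedExtension R K A) (D : Type u) [CommRing D] [Algebra A D]
    [Algebra.Smooth A D] (q : Ideal D) [q.IsPrime] [q.LiesOver (maximalIdeal A)] :
    Nonempty (D →ₐ[A] A) := by
  obtain ⟨f, hf, n, _, _, _⟩ :=
    Algebra.IsSmoothAt.exists_isStandardEtale_mvPolynomial (R := A) (p := q)
  let D' := Localization.Away f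
  let P := MvPolynomial (Fin n) A
  have hopen := PrimeSpectrum.isOpenMap_comap_of_hasGoingDown_of_finitePresentation
    (R := P) (S := D')
  have hdisj : Disjoint (Submonoid.powers f : Set D) q :=
    (Ideal.disjoint_powers_iff_notMem_of_isPrime _).2 hf
  let q' : PrimeSpectrum D' := ⟨q.map (algebraMap D D'),
    IsLocalization.isPrime_of_isPrime_disjoint (.powers f) _ _ ‹_› hdisj⟩
  have hq' : q'.asIdeal.comap (algebraMap D D') = q :=
    IsLocalization.under_map_of_isPrime_disjoint (.powers f) D' ‹_› hdisj
  have hq'A : q'.asIdeal.comap (algebraMap A D') = maximalIdeal A := by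
    rw [IsScalarTower.algebraMap_eq A D D', ← Ideal.comap_comap, hq']
    exact (q.over_def (maximalIdeal A)).symm
  let p := PrimeSpectrum.comap (algebraMap P D') q'
  -- The image of `Spec D'` in affine space is open and meets the special fibre. A residually
  -- rational point of that open set lifts to an `A`-point, and the étale algebra pulled back along
  -- it has a section.
  obtain ⟨_, ⟨_, ⟨g, rfl⟩, rfl⟩, hpg, hg⟩ :=
    PrimeSpectrum.isBasis_basic_opens.exists_subset_of_mem_open (Set.mem_range_self q')
      hopen.isOpen_range
  have hg0 : g.map (residue A) ≠ 0 := by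
    intro hg0
    refine hpg ?_
    have : g ∈ (maximalIdeal A).map (MvPolynomial.C (σ := Fin n)) := by
      rw [MvPolynomial.mem_map_C_iff]
      intro m
      rw [← residue_eq_zero_iff, ← MvPolynomial.coeff_map, hg0, MvPolynomial.coeff_zero]
    refine (Ideal.map_le_iff_le_comap.2 ?_) this
    rw [PrimeSpectrum.comap_asIdeal, Ideal.comap_comap, ← MvPolynomial.algebraMap_eq,
      ← IsScalarTower.algebraMap_eq, hq'A]
  have := h.infinite_residueField
  obtain ⟨a, ha⟩ : ∃ a : Fin n → ResidueField A, (g.map (residue A)).eval a ≠ 0 := by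
    by_contra! hcon
    exact hg0 (MvPolynomial.funext fun x => by simpa using hcon x)
  choose b hb using fun i => residue_surjective (R := A) (a i)
  let ev : P →ₐ[A] A := MvPolynomial.aeval b
  let pa : PrimeSpectrum P := PrimeSpectrum.comap ev.toRingHom (closedPoint A)
  have hpa : pa ∈ PrimeSpectrum.basicOpen g := by
    change ev g ∉ maximalIdeal A
    rw [← residue_eq_zero_iff]
    convert ha
    rw [MvPolynomial.eval_map, MvPolynomial.aeval_def, MvPolynomial.hom_eval₂]
    congr 1
    exact funext hb
  obtain ⟨Q, hQ⟩ := hg hpa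
  let : Algebra P A := ev.toRingHom.toAlgebra
  have : IsScalarTower A P A := .of_algebraMap_eq fun x => (ev.commutes x).symm
  obtain ⟨q₂, _, _⟩ := Ideal.exists_isPrime_tensorProduct (B := P) (maximalIdeal A) Q.asIdeal
    congr(PrimeSpectrum.asIdeal $hQ).symm
  obtain ⟨σ⟩ := h.exists_algHom_of_etale (TensorProduct P A D') q₂
  let τ : D' →ₐ[P] A := (σ.restrictScalars P).comp Algebra.TensorProduct.includeRight
  exact ⟨(τ.restrictScalars A).comp (IsScalarTower.toAlgHom A D D')⟩

end Sections

/-! ### Étale models of finite subextensions -/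

section Etale

open IsLocalRing

variable {R K : Type u} [CommRing R] [Field K] [Algebra R K] [IsDomain R]
  [IsDiscreteValuationRing R] [IsFractionRing R K]
  {L : Type u} [Field L] [Algebra K L] {A : ValuationSubring L}
  {R₀ : Type u} [CommRing R₀] [Algebra R₀ R]

/-- If an essentially finite Dedekind extension `C` of a ring `R₀` maps to an unramified extension
of a localization of `R₀`, it is unramified over `R₀` at the centre of the valuation. -/
theorem IsUnramifiedExtension.isUnramifiedAt (h : IsUnramifiedExtension R K A)
    (p : Ideal R₀) [p.IsPrime] [IsLocalization.AtPrime R p] {C : Type u} [CommRing C]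
    [IsDedekindDomain C] [Algebra R₀ C] [Algebra.EssFiniteType R₀ C] (c : C →+* A)
    (hc : c.comp (algebraMap R₀ C) = h.extendsRing.ringHom.comp (algebraMap R₀ R))
    (q : Ideal C) [q.IsPrime] (hq : q = (maximalIdeal A).comap c) :
    Algebra.IsUnramifiedAt R₀ q := by
  have := h.isDiscreteValuationRing
  have := h.extendsRing.isLocalHom_ringHom
  have hover : q.LiesOver p := ⟨by
    rw [Ideal.under_def, hq, Ideal.comap_comap, hc, ← Ideal.comap_comap,
      maximalIdeal_comap h.extendsRing.ringHom]
    exact (IsLocalization.AtPrime.under_maximalIdeal R p).symm⟩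
  let _ := Localization.AtPrime.algebraOfLiesOver p q
  let Cq := Localization.AtPrime q
  have hφu (y : q.primeCompl) : IsUnit (c y) := by
    by_contra hy
    exact y.2 (hq ▸ (mem_maximalIdeal _).2 hy)
  let φ : Cq →+* A := IsLocalization.lift (M := q.primeCompl) hφu
  have hφ : φ.comp (algebraMap C Cq) = c := IsLocalization.lift_comp hφu
  have hpm : (p.map (algebraMap R₀ Cq)).map φ = maximalIdeal A := by
    refine .trans ?_ h.map_maximalIdeal
    rw [← IsLocalization.AtPrime.map_eq_maximalIdeal p, Ideal.map_map,
      Ideal.map_map, ← hc, IsScalarTower.algebraMap_eq R₀ C Cq, ← RingHom.comp_assoc, hφ]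
  have hA : maximalIdeal A ≠ ⊥ := IsDiscreteValuationRing.not_a_field A
  have hp0 : p.map (algebraMap R₀ Cq) ≠ ⊥ := fun h0 => hA (by rw [← hpm, h0, Ideal.map_bot])
  have hq0 : q ≠ ⊥ := by
    intro h0
    refine hp0 (le_bot_iff.1 ?_)
    rw [IsScalarTower.algebraMap_eq R₀ C Cq, ← Ideal.map_map]
    exact (Ideal.map_mono ((Ideal.map_le_iff_le_comap.2 (q.over_def p).le).trans h0.le)).trans
      Ideal.map_bot.le
  have : IsDiscreteValuationRing Cq :=
    IsLocalization.AtPrime.isDiscreteValuationRing_of_dedekind_domain C hq0 Cq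
  rw [Algebra.isUnramifiedAt_iff_map_eq R₀ p q]
  constructor
  -- The residue field at `q` sits between that at `p` and that of `A`, so it inherits separability.
  · have hle : q ≤ RingHom.ker ((residue A).comp c) := fun x hx =>
      (residue_eq_zero_iff _).2 (hq.le hx)
    have hunit : q.primeCompl ≤ (IsUnit.submonoid (ResidueField A)).comap ((residue A).comp c) :=
      fun x hx => (hφu ⟨x, hx⟩).map (residue A)
    let g : q.ResidueField →+* ResidueField A := Ideal.ResidueField.lift q _ hle hunit
    let _ := g.toAlgebra
    let _ := (g.comp (algebraMap p.ResidueField q.ResidueField)).toAlgebra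
    have : IsScalarTower p.ResidueField q.ResidueField (ResidueField A) :=
      .of_algebraMap_eq fun _ => rfl
    let _ := h.extendsRing.residueFieldMap.toAlgebra
    have := h.isSeparable_residueField
    let e : p.ResidueField ≃+* ResidueField R := ResidueField.mapEquiv
      (IsLocalization.algEquiv p.primeCompl (Localization.AtPrime p) R).toRingEquiv
    have he : (algebraMap (ResidueField R) (ResidueField A)).comp (e : _ →+* _) =
        algebraMap p.ResidueField (ResidueField A) := by
      refine Ideal.ResidueField.ringHom_ext (RingHom.ext fun x => ?_)
      have hx : e (algebraMap R₀ p.ResidueField x) = residue R (algebraMap R₀ R x) := by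
        rw [IsScalarTower.algebraMap_apply R₀ (Localization.AtPrime p) p.ResidueField]
        exact (ResidueField.map_residue _ _).trans
          (congrArg _ (AlgEquiv.commutes _ x))
      have hgx : g (algebraMap C q.ResidueField (algebraMap R₀ C x)) =
          residue A (c (algebraMap R₀ C x)) := Ideal.ResidueField.lift_algebraMap ..
      rw [RingHom.comp_apply, RingHom.comp_apply, RingHom.coe_coe, hx, RingHom.comp_apply,
        RingHom.algebraMap_toAlgebra (g.comp _), RingHom.comp_apply,
        ← IsScalarTower.algebraMap_apply, IsScalarTower.algebraMap_apply R₀ C q.ResidueField, hgx]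
      exact congrArg (residue A) congr($hc x).symm
    have : Algebra.IsSeparable p.ResidueField (ResidueField A) :=
      .of_equiv_equiv e.symm (.refl _) (RingHom.ext fun x => by
        obtain ⟨x, rfl⟩ := e.surjective x
        simpa using congr($he x).symm)
    exact Algebra.isSeparable_tower_bot_of_isSeparable p.ResidueField q.ResidueField
      (ResidueField A)
  -- The extension of `p` to `Cq` is the `n`-th power of the maximal ideal. It generates the maximal
  -- ideal of `A`, which is therefore contained in its own `n`-th power, so `n ≤ 1`; and `n = 0`
  -- would give the unit ideal.
  · obtain ⟨t, ht⟩ := IsDiscreteValuationRing.exists_irreducible Cq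
    obtain ⟨n, hn⟩ := IsDiscreteValuationRing.ideal_eq_span_pow_irreducible hp0 ht
    rw [← Ideal.span_singleton_pow, ← ht.maximalIdeal_eq] at hn
    have hφm : (maximalIdeal Cq).map φ ≤ maximalIdeal A := by
      rw [← Localization.AtPrime.map_eq_maximalIdeal, Ideal.map_map, hφ]
      exact Ideal.map_le_iff_le_comap.2 hq.le
    rw [hn] at hpm ⊢
    rw [Ideal.map_pow] at hpm
    have hn1 : n ≤ 1 := by
      by_contra! hcon
      obtain ⟨ϖ, hϖ⟩ := IsDiscreteValuationRing.exists_irreducible A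
      have h2 : maximalIdeal A ≤ maximalIdeal A ^ 2 :=
        hpm.symm.le.trans ((Ideal.pow_right_mono hφm n).trans (Ideal.pow_le_pow_right hcon))
      rw [hϖ.maximalIdeal_eq, Ideal.span_singleton_pow, Ideal.span_singleton_le_span_singleton,
        ← pow_one ϖ, ← pow_mul, pow_dvd_pow_iff hϖ.ne_zero hϖ.not_isUnit] at h2
      omega
    interval_cases n
    · rw [pow_zero, Ideal.one_eq_top] at hpm
      exact absurd hpm.symm Ideal.IsPrime.ne_top'
    · exact pow_one _

/-- A finite subextension `K'` of an unramified extension is the generic fibre of an étale algebra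
whose elements are integral with respect to the valuation. -/
theorem IsUnramifiedExtension.exists_etale [IsDedekindDomain R₀] [Algebra R₀ K]
    [IsScalarTower R₀ R K] [IsFractionRing R₀ K] (h : IsUnramifiedExtension R K A)
    (p : Ideal R₀) [p.IsPrime] [IsLocalization.AtPrime R p]
    (K' : Type u) [Field K'] [Algebra K K'] [FiniteDimensional K K'] [Algebra K' L]
    [IsScalarTower K K' L] [Algebra R₀ K'] [IsScalarTower R₀ K K'] :
    ∃ (E : Type u) (_ : CommRing E) (_ : Algebra R₀ E) (_ : Algebra E K')
      (_ : IsScalarTower R₀ E K'), Algebra.Etale R₀ E ∧ Algebra.IsPushout R₀ K E K' ∧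
      ∀ x : E, algebraMap K' L (algebraMap E K' x) ∈ A := by
  have := h.isSeparable
  have : Algebra.IsSeparable K K' := Algebra.isSeparable_tower_bot_of_isSeparable K K' L
  let C := integralClosure R₀ K'
  have : IsDedekindDomain C := integralClosure.isDedekindDomain R₀ K K'
  have : Module.Finite R₀ C := IsIntegralClosure.finite R₀ K K' C
  have : FaithfulSMul R₀ K' := by
    rw [faithfulSMul_iff_algebraMap_injective, IsScalarTower.algebraMap_eq R₀ K K']
    exact (algebraMap K K').injective.comp (IsFractionRing.injective R₀ K)
  have hCA (x : C) : algebraMap K' L x ∈ A := by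
    have hx : IsIntegral A (algebraMap K' L x) := by
      refine IsIntegral.map_of_comp_eq (h.extendsRing.ringHom.comp (algebraMap R₀ R))
        (algebraMap K' L) (RingHom.ext fun y => ?_) x.2
      change algebraMap K L (algebraMap R K (algebraMap R₀ R y)) = _
      rw [← IsScalarTower.algebraMap_apply R₀ R K, RingHom.comp_apply,
        IsScalarTower.algebraMap_apply R₀ K K', ← IsScalarTower.algebraMap_apply K K' L]
    obtain ⟨y, hy⟩ := IsIntegrallyClosed.isIntegral_iff.1 hx
    exact hy ▸ y.2
  let c : C →+* A := ((algebraMap K' L).comp (algebraMap C K')).codRestrict A.toSubring hCA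
  let q := (maximalIdeal A).comap c
  have := h.isUnramifiedAt p c (RingHom.ext fun x => Subtype.ext (by
    change algebraMap K' L (algebraMap C K' (algebraMap R₀ C x)) =
      algebraMap K L (algebraMap R K (algebraMap R₀ R x))
    rw [← IsScalarTower.algebraMap_apply R₀ R K, ← IsScalarTower.algebraMap_apply R₀ C K',
        IsScalarTower.algebraMap_apply R₀ K K', ← IsScalarTower.algebraMap_apply K K' L])) q rfl
  have : Algebra.FinitePresentation R₀ C := Algebra.FinitePresentation.of_finiteType.1 inferInstance
  have : Algebra.IsEtaleAt R₀ q := .of_isUnramifiedAt_of_flat q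
  -- Flat and unramified at `q` gives étale near `q`. As `f` avoids the centre `q`, it is a unit in
  -- `A`, so the localization still maps into `A`.
  obtain ⟨f, hf, _⟩ := Algebra.exists_etale_of_isEtaleAt (R := R₀) q
  let E := Localization.Away f
  have hf0 : f ≠ 0 := fun h0 => hf (h0 ▸ q.zero_mem)
  have hfK (y : Submonoid.powers f) : IsUnit (algebraMap C K' y) := by
    obtain ⟨_, n, rfl⟩ := y
    simp [hf0]
  let i : E →+* K' := IsLocalization.lift (M := Submonoid.powers f) hfK
  let _ : Algebra E K' := i.toAlgebra
  have : IsScalarTower C E K' := .of_algebraMap_eq fun x => (IsLocalization.lift_eq hfK x).symm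
  have : IsScalarTower R₀ E K' := .of_algebraMap_eq fun x => by
    rw [IsScalarTower.algebraMap_apply R₀ C E, ← IsScalarTower.algebraMap_apply C E,
      ← IsScalarTower.algebraMap_apply]
  have hinj : Function.Injective i := by
    refine (IsLocalization.lift_injective_iff hfK).2 fun x y => ?_
    rw [(IsLocalization.injective E (powers_le_nonZeroDivisors_of_noZeroDivisors hf0)).eq_iff]
    exact Subtype.val_injective.eq_iff.symm
  refine ⟨E, inferInstance, inferInstance, inferInstance, this, inferInstance, ?_, fun x => ?_⟩
  · have := IsIntegralClosure.isLocalization R₀ K K' C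
    have : IsLocalization (Algebra.algebraMapSubmonoid E (nonZeroDivisors R₀)) K' := by
      refine ⟨?_, ?_, ?_⟩
      · rintro ⟨_, y, hy, rfl⟩
        rw [← IsScalarTower.algebraMap_apply R₀ E K', isUnit_iff_ne_zero, ne_eq,
          FaithfulSMul.algebraMap_eq_zero_iff]
        exact nonZeroDivisors.ne_zero hy
      · intro z
        obtain ⟨⟨a, ⟨_, y, hy, rfl⟩⟩, hay⟩ := IsLocalization.surj
          (Algebra.algebraMapSubmonoid C (nonZeroDivisors R₀)) z
        refine ⟨⟨algebraMap C E a, ⟨_, y, hy, rfl⟩⟩, ?_⟩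
        rw [← IsScalarTower.algebraMap_apply C E K', ← hay, ← IsScalarTower.algebraMap_apply,
          ← IsScalarTower.algebraMap_apply]
      · intro x y hxy
        exact ⟨1, by rw [hinj hxy]⟩
    exact (Algebra.isPushout_of_isLocalization (nonZeroDivisors R₀) K E K').symm
  · obtain ⟨⟨a, ⟨_, n, rfl⟩⟩, hay⟩ := IsLocalization.surj (Submonoid.powers f) x
    have hu : IsUnit (c (f ^ n)) := by
      rw [map_pow]
      refine IsUnit.pow n (not_not.1 fun hu => hf ((mem_maximalIdeal _).2 hu))
    obtain ⟨b, hb⟩ := hu.exists_right_inv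
    have h1 := congrArg (fun z => algebraMap K' L (algebraMap E K' z)) hay
    simp only [map_mul, ← IsScalarTower.algebraMap_apply C E K'] at h1
    have h2 : algebraMap K' L (algebraMap C K' (f ^ n)) * b = 1 := congrArg Subtype.val hb
    have h3 : algebraMap K' L (algebraMap E K' x) = (c a * b : A) := by
      rw [← mul_one (algebraMap K' L _), ← h2, ← mul_assoc, h1]
      rfl
    exact h3 ▸ (c a * b).2

end Etale

/-! ### Topology and adic completeness of valued fields -/

section ValuedField

open Topology Filter

variable {F Γ : Type*} [Field F] [LinearOrderedCommGroupWithZero Γ] [Valued F Γ]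

theorem Valued.mem_nhds_iff_exists_ne_zero {s : Set F} {x : F} :
    s ∈ 𝓝 x ↔ ∃ c : F, c ≠ 0 ∧ ∀ y, Valued.v (y - x) < Valued.v c → y ∈ s := by
  rw [Valued.mem_nhds]
  constructor
  · rintro ⟨γ, hγ⟩
    obtain ⟨c, hc⟩ := MonoidWithZeroHom.ValueGroup₀.restrict₀_surjective
        (.ofClass (Valued.v (R := F))) (γ : _)
    refine ⟨c, fun h0 => γ.ne_zero (by rw [← hc, h0, map_zero]), fun y hy => hγ ?_⟩
    rw [Set.mem_ofPred_eq, ← hc]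
    exact (Valuation.restrict_lt_iff _).2 hy
  · rintro ⟨c, hc, h⟩
    refine ⟨Units.mk0 (Valued.v.restrict c) (by simpa using hc), fun y hy => h y ?_⟩
    exact (Valuation.restrict_lt_iff _).1 hy

theorem Valued.ball_mem_nhds (x : F) {c : F} (hc : c ≠ 0) :
    {y | Valued.v (y - x) < Valued.v c} ∈ 𝓝 x :=
  Valued.mem_nhds_iff_exists_ne_zero.2 ⟨c, hc, fun _ hy => hy⟩

theorem Valued.isClosed_setOf_v_sub_le (x c : F) :
    IsClosed {y | Valued.v (y - x) ≤ Valued.v c} := by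
  have h := (Valued.isClosed_closedBall F (Valued.v.restrict c)).preimage
    (continuous_id.sub (continuous_const (y := x)))
  convert h using 1
  ext y
  exact (Valuation.restrict_le_iff _).symm

variable [CompleteSpace F]

/-- Congruence modulo the `n`-th power of `ϖ` means lying in a common closed ball (`key`), and `hϖ`
makes these balls arbitrarily small. Adic Cauchy sequences are then Cauchy for the valuation, and
limits stay in closed balls. -/
theorem Valued.isAdicComplete_span (ϖ : (Valued.v (R := F)).valuationSubring)
    (hϖ : ∀ c : F, c ≠ 0 → ∃ n : ℕ, Valued.v ((ϖ : F) ^ n) < Valued.v c) :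
    IsAdicComplete (Ideal.span {ϖ}) (Valued.v (R := F)).valuationSubring := by
  have key (n : ℕ) (x y : (Valued.v (R := F)).valuationSubring) :
      x ≡ y [SMOD (Ideal.span {ϖ} ^ n • ⊤ : Ideal _)] ↔
        Valued.v (x - y : F) ≤ Valued.v ((ϖ : F) ^ n) := by
    rw [SModEq.sub_mem, smul_eq_mul, Ideal.mul_top, Ideal.span_singleton_pow,
      Ideal.mem_span_singleton]
    constructor
    · rintro ⟨z, hz⟩
      have h1 : (x - y : F) = ϖ ^ n * z := congrArg Subtype.val hz
      rw [h1, map_mul]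
      exact mul_le_of_le_one_right' z.2
    · intro hle
      by_cases h0 : (ϖ : F) ^ n = 0
      · rw [h0, map_zero, le_zero_iff, Valuation.zero_iff] at hle
        exact ⟨0, Subtype.ext (by simpa using hle)⟩
      · refine ⟨⟨(x - y) / ϖ ^ n, ?_⟩, Subtype.ext ?_⟩
        · rw [Valuation.mem_valuationSubring_iff, map_div₀]
          exact div_le_one_of_le₀ hle zero_le
        · change (x - y : F) = ϖ ^ n * ((x - y) / ϖ ^ n)
          field_simp
  have anti (c : F) (hc : c ≠ 0) : ∃ n : ℕ, ∀ m ≥ n, Valued.v ((ϖ : F) ^ m) < Valued.v c := by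
    obtain ⟨n, hn⟩ := hϖ c hc
    refine ⟨n, fun m hm => lt_of_le_of_lt ?_ hn⟩
    rw [map_pow, map_pow]
    exact pow_le_pow_right_of_le_one' ϖ.2 hm
  refine { haus' := fun x hx => ?_, prec' := fun f hf => ?_ }
  · by_contra hx0
    obtain ⟨n, hn⟩ := hϖ x fun h => hx0 (Subtype.ext h)
    have := (key n x 0).1 (hx n)
    rw [ZeroMemClass.coe_zero, sub_zero] at this
    exact this.not_gt hn
  · simp only [key] at hf
    have hcau : CauchySeq fun n => (f n : F) := by
      refine Valued.cauchy_iff.2 ⟨inferInstance, fun γ => ?_⟩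
      obtain ⟨c, hc⟩ := MonoidWithZeroHom.ValueGroup₀.restrict₀_surjective
        (.ofClass (Valued.v (R := F))) (γ : _)
      obtain ⟨n, hn⟩ := anti c fun h0 => γ.ne_zero (by rw [← hc, h0, map_zero])
      refine ⟨_, image_mem_map (Ici_mem_atTop n), ?_⟩
      rintro _ ⟨i, hi, rfl⟩ _ ⟨j, hj, rfl⟩
      rw [← hc]
      refine (Valuation.restrict_lt_iff _).2 ?_
      rcases le_total i j with h | h
      · rw [Valuation.map_sub_swap]
        exact (hf h).trans_lt (hn i hi)
      · exact (hf h).trans_lt (hn j hj)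
    obtain ⟨l, hl⟩ := cauchySeq_tendsto_of_complete hcau
    have hlim (n : ℕ) : Valued.v (l - f n : F) ≤ Valued.v ((ϖ : F) ^ n) := by
      refine (Valued.isClosed_setOf_v_sub_le (f n : F) _).mem_of_tendsto hl ?_
      filter_upwards [Ici_mem_atTop n] with m hm
      exact (Valuation.map_sub_swap _ _ _).trans_le (hf hm)
    refine ⟨⟨l, ?_⟩, fun n => (key _ _ _).2 ?_⟩
    · have := hlim 0
      rw [pow_zero, map_one] at this
      rw [Valuation.mem_valuationSubring_iff, ← sub_add_cancel l (f 0 : F)]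
      exact Valuation.map_add_le _ this (f 0).2
    · rw [Valuation.map_sub_swap]
      exact hlim n

end ValuedField

/-! ### Newton's criterion over Henselian valued fields -/

section HenselianField

open Polynomial

variable {F Γ : Type*} [Field F] [LinearOrderedCommGroupWithZero Γ] {v : Valuation F Γ}

theorem Valuation.mem_maximalIdeal_valuationSubring_iff {x : v.valuationSubring} :
    x ∈ IsLocalRing.maximalIdeal v.valuationSubring ↔ v (x : F) < 1 := by
  rw [IsLocalRing.mem_maximalIdeal, mem_nonunits_iff, lt_iff_le_and_ne,
    and_iff_right ((v.mem_valuationSubring_iff _).1 x.2), not_iff_not]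
  constructor
  · intro h
    obtain ⟨y, hy⟩ := h.exists_right_inv
    refine le_antisymm x.2 ?_
    have h1 : v (x : F) * v (y : F) = 1 := by
      rw [← map_mul]
      exact (congrArg v (congrArg Subtype.val hy)).trans v.map_one
    exact h1 ▸ mul_le_of_le_one_right' y.2
  · intro h
    have hx : (x : F) ≠ 0 := fun h0 => by simp [h0] at h
    exact .of_mul_eq_one ⟨(x : F)⁻¹, by rw [v.mem_valuationSubring_iff, map_inv₀, h, inv_one]⟩
      (Subtype.ext (mul_inv_cancel₀ hx))

/-- Newton's criterion for the existence of a small root. -/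
theorem Valuation.exists_root_of_coeff_lt [HenselianLocalRing v.valuationSubring] (p : F[X])
    (h1 : p.coeff 1 ≠ 0)
    (h : ∀ i, 2 ≤ i → i ≤ p.natDegree → v (p.coeff i * p.coeff 0 ^ (i - 1)) < v (p.coeff 1 ^ i)) :
    ∃ y : F, p.eval y = 0 ∧ v y = v (p.coeff 0 / p.coeff 1) := by
  by_cases h0 : p.coeff 0 = 0
  · exact ⟨0, by rw [← coeff_zero_eq_eval_zero, h0], by simp [h0]⟩
  let d := p.natDegree
  have hd : 1 ≤ d := le_natDegree_of_ne_zero h1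
  let c (i : ℕ) : F := (-1) ^ i * (p.coeff i * p.coeff 0 ^ (i - 1)) / p.coeff 1 ^ i
  have hc (i : ℕ) (hi : i ∈ Finset.Ico 2 (d + 1)) : v (c i) < 1 := by
    rw [Finset.mem_Ico] at hi
    have hv : v ((-1) ^ i) = 1 := by rw [map_pow, Valuation.map_neg, map_one, one_pow]
    rw [map_div₀, map_mul v, hv, one_mul]
    exact (div_lt_one₀ (by rw [Valuation.pos_iff]; exact pow_ne_zero _ h1)).2
      (h i hi.1 (by omega))
  let c' (i : ℕ) : v.valuationSubring :=
    if hi : i ∈ Finset.Ico 2 (d + 1) then ⟨c i, (hc i hi).le⟩ else 0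
  have hc' (i : ℕ) (hi : i ∈ Finset.Ico 2 (d + 1)) : (c' i : F) = c i := by
    simp only [c', dif_pos hi]
  have hcm (i : ℕ) : c' i ∈ IsLocalRing.maximalIdeal v.valuationSubring := by
    by_cases hi : i ∈ Finset.Ico 2 (d + 1)
    · rw [Valuation.mem_maximalIdeal_valuationSubring_iff, hc' i hi]
      exact hc i hi
    · simp only [c', dif_neg hi, Submodule.zero_mem]
  let l : (v.valuationSubring)[X] :=
    -X ^ (d - 1) + ∑ i ∈ Finset.Ico 2 (d + 1), C (c' i) * X ^ (d - i)
  have hl : l.degree < d := by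
    rw [← mem_degreeLT]
    refine Submodule.add_mem _ (Submodule.neg_mem _ ?_) (Submodule.sum_mem _ fun i hi => ?_)
    · rw [mem_degreeLT, degree_X_pow]
      exact_mod_cast Nat.sub_lt hd one_pos
    · rw [mem_degreeLT]
      refine (degree_C_mul_X_pow_le _ _).trans_lt ?_
      rw [Finset.mem_Ico] at hi
      exact_mod_cast (by omega : d - i < d)
  obtain ⟨s, hs, hs1⟩ := HenselianLocalRing.is_henselian _ (monic_X_pow_add hl) 1
    (by
      simp only [l, eval_add, eval_neg, eval_pow, eval_X, one_pow, eval_finsetSum, eval_mul,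
        eval_C, mul_one, add_neg_cancel_left]
      exact Ideal.sum_mem _ fun i _ => hcm i)
    (by
      have hm : ∑ i ∈ Finset.Ico 2 (d + 1), c' i * ((d - i : ℕ) : v.valuationSubring) ∈
          IsLocalRing.maximalIdeal v.valuationSubring :=
        Ideal.sum_mem _ fun i _ => Ideal.mul_mem_right _ _ (hcm i)
      have he : (derivative (X ^ d + l)).eval 1 =
          1 + ∑ i ∈ Finset.Ico 2 (d + 1), c' i * ((d - i : ℕ) : v.valuationSubring) := by
        simp only [l, derivative_add, derivative_neg, derivative_X_pow, derivative_sum,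
          derivative_C_mul, eval_add, eval_neg, eval_mul, eval_C, eval_pow, eval_X, one_pow,
          mul_one, eval_finsetSum, ← add_assoc, Nat.cast_sub hd, Nat.cast_one]
        ring
      rw [he]
      by_contra hu
      exact (Ideal.ne_top_iff_one _).1 (IsLocalRing.maximalIdeal.isMaximal _).ne_top
        ((Ideal.add_mem_iff_left _ hm).1 hu))
  have hsv : v (s : F) = 1 := by
    rw [Valuation.mem_maximalIdeal_valuationSubring_iff] at hs1
    have := Valuation.map_one_add_of_lt v hs1
    simpa using this
  have hs0 : (s : F) ≠ 0 := fun h => by simp [h] at hsv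
  refine ⟨-(p.coeff 0 / p.coeff 1) / s, ?_, by rw [map_div₀, hsv, Valuation.map_neg, div_one]⟩
  have hs' : (s : F) ^ d + (-(s : F) ^ (d - 1) +
      ∑ i ∈ Finset.Ico 2 (d + 1), c i * (s : F) ^ (d - i)) = 0 := by
    have h2 := congrArg v.valuationSubring.subtype hs
    simp only [l, eval_add, eval_neg, eval_pow, eval_X, eval_finsetSum, eval_mul, eval_C, map_add,
      map_pow, map_sum, map_mul, map_zero, ValuationSubring.subtype_apply] at h2
    have hsum : ∑ i ∈ Finset.Ico 2 (d + 1), c i * (s : F) ^ (d - i) =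
        ∑ i ∈ Finset.Ico 2 (d + 1), (c' i : F) * (s : F) ^ (d - i) :=
      Finset.sum_congr rfl fun i hi => by rw [hc' i hi]
    rw [hsum]
    exact h2
  have hterm (i : ℕ) (hi : i ∈ Finset.Ico 2 (d + 1)) :
      p.coeff i * (-(p.coeff 0 / p.coeff 1) / s) ^ i =
        p.coeff 0 / s ^ d * (c i * (s : F) ^ (d - i)) := by
    rw [Finset.mem_Ico] at hi
    obtain ⟨j, rfl⟩ : ∃ j, i = j + 1 := ⟨i - 1, by omega⟩
    have hsd : (s : F) ^ d = s ^ (j + 1) * s ^ (d - (j + 1)) := by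
      rw [← pow_add]
      congr 1
      omega
    simp only [c, hsd, add_tsub_cancel_right]
    rw [neg_div, neg_pow, div_pow, div_pow]
    field_simp
    ring
  rw [eval_eq_sum_range, Finset.range_eq_Ico, Finset.sum_eq_sum_Ico_succ_bot (by omega),
    Finset.sum_eq_sum_Ico_succ_bot (by omega), Finset.sum_congr rfl hterm, ← Finset.mul_sum,
    eq_sub_of_add_eq' (eq_neg_of_add_eq_zero_right hs')]
  have hsd : (s : F) ^ d = s * s ^ (d - 1) := by
    rw [← pow_succ']
    congr 1
    omega
  simp only [hsd, pow_zero, zero_add, pow_one]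
  field_simp
  ring

end HenselianField

/-! ### Deforming points of smooth algebras -/

section Deformation

open Topology Filter TensorProduct

attribute [local instance] MvPolynomial.algebraMvPolynomial

variable {F Γ : Type*} [Field F] [LinearOrderedCommGroupWithZero Γ] [Valued F Γ]
  [HenselianLocalRing (Valued.v (R := F)).valuationSubring]
  {R E X : Type*} [CommRing R] [CommRing E] [Algebra R E] [TopologicalSpace X]

/-- The Taylor coefficients at `y` of the specialized polynomial vary continuously. At `a` the
constant one vanishes and the linear one does not, so Newton's criterion applies near `a` and gives
a root close enough to `y` to keep `g` nonzero. -/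
theorem StandardEtalePair.eventually_exists_root (P : StandardEtalePair R) (e : X → R →+* F)
    (he : ∀ r, Continuous fun b => e b r) (a : X) (y : F) (hy : P.f.eval₂ (e a) y = 0)
    (hg : P.g.eval₂ (e a) y ≠ 0) :
    ∀ᶠ b in 𝓝 a, ∃ y', P.f.eval₂ (e b) y' = 0 ∧ P.g.eval₂ (e b) y' ≠ 0 := by
  have hcont (p : Polynomial R) (i : ℕ) :
      Continuous fun b => (Polynomial.taylor y (p.map (e b))).coeff i := by
    have hp (b : X) : (Polynomial.taylor y (p.map (e b))).coeff i =
        ∑ j ∈ Finset.range (p.natDegree + 1), e b (p.coeff j) *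
          (Polynomial.taylor y (Polynomial.X ^ j)).coeff i := by
      conv_lhs => rw [p.as_sum_range_C_mul_X_pow]
      simp only [Polynomial.map_sum, Polynomial.map_mul, Polynomial.map_C,
        Polynomial.map_pow, Polynomial.map_X, map_sum, Polynomial.taylor_mul, Polynomial.taylor_C,
        Polynomial.finsetSum_coeff, Polynomial.coeff_C_mul]
    simp_rw [hp]
    exact continuous_finsetSum _ fun j _ => (he _).mul continuous_const
  let c (i : ℕ) (b : X) : F := (Polynomial.taylor y (P.f.map (e b))).coeff i
  have hc0 : c 0 a = 0 := by
    simp only [c, Polynomial.taylor_coeff_zero, Polynomial.eval_map, hy]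
  have hc1 : c 1 a ≠ 0 := by
    have h1 : P.f.derivative.eval₂ (e a) y ≠ 0 := by
      let _ := (e a).toAlgebra
      exact (StandardEtalePair.HasMap.isUnit_derivative_f P (x := y)
        ⟨hy, isUnit_iff_ne_zero.2 hg⟩).ne_zero
    simpa only [c, Polynomial.taylor_coeff_one, Polynomial.derivative_map, Polynomial.eval_map] using h1
  have hev1 : ∀ᶠ b in 𝓝 a, c 1 b ≠ 0 := (hcont P.f 1).continuousAt.eventually_ne hc1
  have hlt (f : X → F) (hf : ContinuousAt f a) (hf0 : f a = 0) (t : F) (ht : t ≠ 0) :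
      ∀ᶠ b in 𝓝 a, Valued.v (f b) < Valued.v t := by
    have := hf (hf0 ▸ Valued.ball_mem_nhds 0 ht)
    filter_upwards [this] with b hb
    have hb' : Valued.v (f b - f a) < Valued.v t := hb
    rwa [hf0, sub_zero] at hb'
  have hev2 (i : ℕ) (hi : 2 ≤ i) : ∀ᶠ b in 𝓝 a,
      Valued.v (c i b * c 0 b ^ (i - 1) / c 1 b ^ i) < Valued.v (1 : F) := by
    refine hlt (fun b => c i b * c 0 b ^ (i - 1) / c 1 b ^ i)
      (ContinuousAt.div ?_ ?_ (pow_ne_zero _ hc1)) ?_ 1 one_ne_zero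
    · exact ((hcont P.f i).mul ((hcont P.f 0).pow _)).continuousAt
    · exact ((hcont P.f 1).pow _).continuousAt
    · rw [hc0, zero_pow (by omega), mul_zero, zero_div]
  have hgc : Continuous fun x : X × F => (P.g.map (e x.1)).eval (x.2 + y) := by
    simp_rw [Polynomial.eval_map, Polynomial.eval₂_eq_sum_range]
    exact continuous_finsetSum _ fun j _ => ((he _).comp continuous_fst).mul
      ((continuous_snd.add continuous_const).pow _)
  have hev3 : ∀ᶠ x in 𝓝 a ×ˢ 𝓝 (0 : F), (P.g.map (e x.1)).eval (x.2 + y) ≠ 0 := by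
    rw [← nhds_prod_eq]
    refine hgc.continuousAt.eventually_ne ?_
    simpa only [zero_add, Polynomial.eval_map] using hg
  obtain ⟨U, hU, V, hV, hUV⟩ := Filter.eventually_prod_iff.1 hev3
  obtain ⟨t, ht, htV⟩ := Valued.mem_nhds_iff_exists_ne_zero.1 hV
  have hev4 : ∀ᶠ b in 𝓝 a, Valued.v (c 0 b / c 1 b) < Valued.v t :=
    hlt (fun b => c 0 b / c 1 b) (ContinuousAt.div (hcont P.f 0).continuousAt
      (hcont P.f 1).continuousAt hc1)
      (by rw [hc0, zero_div]) t ht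
  have hev5 := (Finset.Icc 2 P.f.natDegree).eventually_all.2 fun i hi =>
    hev2 i (Finset.mem_Icc.1 hi).1
  filter_upwards [hev1, hev4, hev5, hU] with b hb1 hb4 hb5 hbU
  obtain ⟨δ, hδ0, hδ⟩ := Valuation.exists_root_of_coeff_lt (v := Valued.v)
    (Polynomial.taylor y (P.f.map (e b))) hb1 (fun i hi hid => by
      have := hb5 i (Finset.mem_Icc.2 ⟨hi, hid.trans ?_⟩)
      · rw [map_div₀, map_one] at this
        refine (div_lt_one₀ ?_).1 this
        rw [Valuation.pos_iff]
        exact pow_ne_zero _ hb1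
      · rw [Polynomial.natDegree_taylor]
        exact Polynomial.natDegree_map_le)
  refine ⟨δ + y, by rwa [← Polynomial.eval_map, ← Polynomial.taylor_eval], ?_⟩
  rw [← Polynomial.eval_map]
  refine hUV hbU (htV δ ?_)
  rw [sub_zero, hδ]
  exact hb4

/-- A point of an étale algebra over a Henselian valued field deforms along with its image. -/
theorem Algebra.IsEtaleAt.eventually_exists_ringHom [Algebra.IsStandardEtale R E]
    (e : X → R →+* F) (he : ∀ r, Continuous fun b => e b r) (a : X) (z : E →+* F)
    (hz : z.comp (algebraMap R E) = e a) :
    ∀ᶠ b in 𝓝 a, ∃ z' : E →+* F, z'.comp (algebraMap R E) = e b := by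
  obtain ⟨P⟩ := Algebra.IsStandardEtale.nonempty_standardEtalePresentation (R := R) (S := E)
  have hzP (p : Polynomial R) : p.eval₂ (e a) (z P.x) = z (p.aeval P.x) := by
    rw [Polynomial.aeval_def, Polynomial.hom_eval₂, hz]
  have hP := P.hasMap
  filter_upwards [P.P.eventually_exists_root e he a (z P.x)
    (by rw [hzP, hP.1, map_zero]) (by rw [hzP]; exact (hP.2.map z).ne_zero)] with b hb
  obtain ⟨y, hy, hy'⟩ := hb
  let _ := (e b).toAlgebra
  let z' : E →ₐ[R] F := (P.lift y ⟨hy, isUnit_iff_ne_zero.2 hy'⟩).comp P.equivRing.toAlgHom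
  exact ⟨z', z'.comp_algebraMap⟩

/-- Near the given point, `E` is étale over an affine space over `R`. The affine coordinates `t` are
frozen and only the étale part moves. -/
theorem Algebra.Smooth.eventually_exists_ringHom [Algebra.Smooth R E] (e : X → R →+* F)
    (he : ∀ r, Continuous fun b => e b r) (a : X) (z : E →+* F)
    (hz : z.comp (algebraMap R E) = e a) :
    ∀ᶠ b in 𝓝 a, ∃ z' : E →+* F, z'.comp (algebraMap R E) = e b := by
  have := RingHom.ker_isPrime z
  obtain ⟨f, hf, n, _, _, _⟩ := Algebra.IsSmoothAt.exists_isStandardEtale_mvPolynomial (R := R)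
    (p := RingHom.ker z)
  let zf : Localization.Away f →+* F := IsLocalization.Away.lift f (isUnit_iff_ne_zero.2 hf)
  have hzf : zf.comp (algebraMap E _) = z := IsLocalization.Away.lift_comp ..
  let t (i : Fin n) : F := zf (algebraMap (MvPolynomial (Fin n) R) _ (.X i))
  have hC (b : X) : (MvPolynomial.eval₂Hom (e b) t).comp (algebraMap R _) = e b :=
    MvPolynomial.eval₂Hom_comp_C ..
  refine (Algebra.IsEtaleAt.eventually_exists_ringHom (R := MvPolynomial (Fin n) R)
    (fun b => MvPolynomial.eval₂Hom (e b) t) (fun r => ?_) a zf ?_).mono ?_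
  · simp only [MvPolynomial.coe_eval₂Hom, MvPolynomial.eval₂_eq]
    exact continuous_finsetSum _ fun j _ => (he _).mul continuous_const
  · refine MvPolynomial.ringHom_ext' ?_ fun i => ?_
    · rw [← MvPolynomial.algebraMap_eq, hC, RingHom.comp_assoc, ← IsScalarTower.algebraMap_eq,
        IsScalarTower.algebraMap_eq R E, ← RingHom.comp_assoc, hzf, hz]
    · simp [t]
  · rintro b ⟨z', hz'⟩
    refine ⟨z'.comp (algebraMap E _), ?_⟩
    rw [RingHom.comp_assoc, ← IsScalarTower.algebraMap_eq,
      IsScalarTower.algebraMap_eq R (MvPolynomial (Fin n) R), ← RingHom.comp_assoc, hz', hC]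

/-- A point of a smooth algebra over `F ⊗ B` may be moved to one whose image in `Spec B` is
rational over a dense separably closed subfield of `F`. -/
theorem exists_ringHom_forall_mem_range
    (K : Type*) {L B C D : Type*} [Field K] [Field L] [CommRing B] [CommRing C] [CommRing D]
    [Algebra K L] [Algebra L F] [Algebra K F] [IsScalarTower K L F] (n : ℕ) [Algebra K B]
    [Algebra (MvPolynomial (Fin n) K) B] [IsScalarTower K (MvPolynomial (Fin n) K) B]
    [Algebra.Etale (MvPolynomial (Fin n) K) B]
    [Algebra F C] [Algebra B C] [Algebra K C] [IsScalarTower K F C] [IsScalarTower K B C]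
    [Algebra.IsPushout K F B C] [Algebra C D] [Algebra.Smooth C D]
    (hd : DenseRange (algebraMap L F))
    (hsep : ∀ x : F, IsSeparable L x → x ∈ (algebraMap L F).range) (z : D →+* F)
    (hz : z.comp ((algebraMap C D).comp (algebraMap F C)) = RingHom.id F) :
    ∃ z' : D →+* F, z'.comp ((algebraMap C D).comp (algebraMap F C)) = RingHom.id F ∧
      ∀ b : B, z' (algebraMap C D (algebraMap B C b)) ∈ (algebraMap L F).range := by
  let P := MvPolynomial (Fin n) K
  let Q := MvPolynomial (Fin n) F
  let φ : Q →ₐ[F] C := MvPolynomial.aeval fun i => algebraMap B C (algebraMap P B (.X i))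
  let _ : Algebra Q C := φ.toAlgebra
  let _ : Algebra P C := ((algebraMap B C).comp (algebraMap P B)).toAlgebra
  have : IsScalarTower P B C := .of_algebraMap_eq fun _ => rfl
  have : IsScalarTower F Q C := .of_algebraMap_eq fun x => (φ.commutes x).symm
  have : IsScalarTower K P C := .of_algebraMap_eq fun x => by
    rw [IsScalarTower.algebraMap_apply K B C, IsScalarTower.algebraMap_apply K P B]
    rfl
  have : IsScalarTower P Q C := .of_algebraMap_eq' <| MvPolynomial.ringHom_ext'
    (RingHom.ext fun x => by
      change algebraMap P C (algebraMap K P x) = algebraMap Q C (algebraMap P Q (algebraMap K P x))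
      rw [← IsScalarTower.algebraMap_apply, ← IsScalarTower.algebraMap_apply K P Q,
        IsScalarTower.algebraMap_apply K F Q, ← IsScalarTower.algebraMap_apply F Q C,
        ← IsScalarTower.algebraMap_apply])
    fun i => by
      change algebraMap B C (algebraMap P B (.X i)) = φ (algebraMap P Q (.X i))
      rw [MvPolynomial.algebraMap_def, MvPolynomial.map_X, MvPolynomial.aeval_X]
  have : IsScalarTower K Q C := .of_algebraMap_eq fun x => by
    rw [IsScalarTower.algebraMap_apply K F C, IsScalarTower.algebraMap_apply F Q C,
      ← IsScalarTower.algebraMap_apply K F Q]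
  have : Algebra.IsPushout K B F C := .symm inferInstance
  -- `C` is also the base change of `B` from polynomials over `K` to polynomials over `F`, hence
  -- étale over the latter.
  have : Algebra.IsPushout P B Q C := (Algebra.IsPushout.comp_iff K P F Q).1 this
  have : Algebra.IsPushout P Q B C := .symm this
  have : Algebra.Etale Q C := .of_equiv (Algebra.IsPushout.equiv P Q B C)
  let _ : Algebra Q D := ((algebraMap C D).comp (algebraMap Q C)).toAlgebra
  have : IsScalarTower Q C D := .of_algebraMap_eq fun _ => rfl
  have : Algebra.Smooth Q D := .comp Q C D
  have hev := Algebra.Smooth.eventually_exists_ringHom (R := Q) (E := D)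
    (X := Fin n → F) (fun b => MvPolynomial.eval b) (fun r => r.continuous_eval)
    (fun i => z (algebraMap Q D (.X i))) z (MvPolynomial.ringHom_ext'
      (RingHom.ext fun x => by
        change z (algebraMap C D (algebraMap Q C (algebraMap F Q x))) = MvPolynomial.eval _ (.C x)
        rw [MvPolynomial.eval_C, ← IsScalarTower.algebraMap_apply F Q C]
        exact congr($hz x))
      fun i => by rw [MvPolynomial.eval_X]; rfl)
  -- By density, the coordinates of the image in affine space can be moved into `L`.
  obtain ⟨l, z', hz'⟩ := (DenseRange.piMap fun _ : Fin n => hd).mem_nhds hev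
  refine ⟨z', RingHom.ext fun x => ?_, fun b => hsep _ ?_⟩
  · change z' (algebraMap C D (algebraMap F C x)) = x
    rw [IsScalarTower.algebraMap_apply F Q C, ← IsScalarTower.algebraMap_apply Q C D]
    refine congr($hz' (algebraMap F Q x)).trans ?_
    rw [MvPolynomial.algebraMap_eq, MvPolynomial.eval_C]
  · let ε : P →ₐ[K] L := MvPolynomial.aeval l
    let _ : Algebra P L := ε.toAlgebra
    let _ : Algebra P F := ((algebraMap L F).comp (algebraMap P L)).toAlgebra
    have : IsScalarTower P L F := .of_algebraMap_eq fun _ => rfl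
    let w : B →ₐ[P] F :=
      { z'.comp ((algebraMap C D).comp (algebraMap B C)) with
        commutes' := fun p => by
          have hp : (z'.comp (algebraMap Q D)).comp (algebraMap P Q) =
              (algebraMap L F).comp (algebraMap P L) := by
            rw [hz']
            refine MvPolynomial.ringHom_ext' (RingHom.ext fun x => ?_) fun i => ?_
            · change MvPolynomial.eval _ (algebraMap P Q (.C x)) = algebraMap L F (ε (.C x))
              rw [MvPolynomial.algebraMap_def, MvPolynomial.map_C, MvPolynomial.eval_C,
                MvPolynomial.aeval_C, ← IsScalarTower.algebraMap_apply]
            · change MvPolynomial.eval _ (algebraMap P Q (.X i)) = algebraMap L F (ε (.X i))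
              rw [MvPolynomial.algebraMap_def, MvPolynomial.map_X, MvPolynomial.eval_X,
                MvPolynomial.aeval_X]
              rfl
          refine Eq.trans ?_ congr($hp p)
          change z' (algebraMap C D (algebraMap P C p)) =
            z' (algebraMap C D (algebraMap Q C (algebraMap P Q p)))
          rw [← IsScalarTower.algebraMap_apply P Q C] }
    let T := TensorProduct P L B
    let ψ : T →ₐ[L] F := Algebra.TensorProduct.lift (Algebra.ofId L F) w fun _ _ => .all _ _
    have := RingHom.ker_isPrime ψ
    -- `T` is étale over `L`, so its image in `F` is separable over `L`; `hsep` then places the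
    -- values on `B` in `L`.
    have hs : Algebra.IsSeparable L (T ⧸ RingHom.ker ψ) := inferInstance
    let ψ' : (T ⧸ RingHom.ker ψ) →ₐ[L] F := Ideal.kerLiftAlg ψ
    have hb : ψ' (Ideal.Quotient.mk _ (1 ⊗ₜ b)) =
        z' (algebraMap C D (algebraMap B C b)) := by
      change ψ (1 ⊗ₜ b) = _
      rw [Algebra.TensorProduct.lift_tmul, map_one, one_mul]
      rfl
    rw [← hb]
    exact (hs.isSeparable' _).map ψ' (Ideal.kerLiftAlg_injective ψ)

end Deformation

/-! ### The completion of `L` is Henselian and `L` is separably closed in it -/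

section Completion

open Topology

variable {L : Type u} [Field L] (A : ValuationSubring L)

theorem ValuationSubring.valued_toFieldCompletion (x : L) :
    Valued.v (A.toFieldCompletion x) = A.valuation x :=
  Valued.valuedCompletion_apply _

theorem ValuationSubring.denseRange_toFieldCompletion : DenseRange A.toFieldCompletion :=
  UniformSpace.Completion.denseRange_coe.comp (WithVal.equiv A.valuation).symm.surjective.denseRange
    (UniformSpace.Completion.continuous_coe _)

theorem ValuationSubring.exists_valuation_eq (x : A.FieldCompletion) :
    ∃ l : L, Valued.v x = A.valuation l := by
  obtain ⟨r, hr⟩ := Valued.exists_coe_eq_v x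
  exact ⟨WithVal.equiv _ r, hr⟩

theorem ValuationSubring.exists_valued_sub_lt (x : A.FieldCompletion) {c : A.FieldCompletion}
    (hc : c ≠ 0) : ∃ l : L, Valued.v (A.toFieldCompletion l - x) < Valued.v c :=
  A.denseRange_toFieldCompletion.mem_nhds (Valued.ball_mem_nhds x hc)

/-- Completion adds no new values, so a uniformizer of `A` still generates the maximal ideal, for
which the ring is adically complete. -/
theorem ValuationSubring.henselianLocalRing_fieldCompletion [IsDiscreteValuationRing A] :
    HenselianLocalRing (Valued.v (R := A.FieldCompletion)).valuationSubring := by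
  obtain ⟨ϖ, hϖ⟩ := IsDiscreteValuationRing.exists_irreducible A
  have hϖ1 : A.valuation ϖ < 1 := (A.valuation_lt_one_iff _).1 hϖ.not_isUnit
  have hϖ0 : (ϖ : L) ≠ 0 := fun h => hϖ.ne_zero (Subtype.ext h)
  let V := (Valued.v (R := A.FieldCompletion)).valuationSubring
  let ϖ' : V := ⟨A.toFieldCompletion ϖ, by
    rw [Valuation.mem_valuationSubring_iff, A.valued_toFieldCompletion]
    exact hϖ1.le⟩
  have hv : Valued.v (ϖ' : A.FieldCompletion) = A.valuation ϖ := A.valued_toFieldCompletion _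
  have : IsAdicComplete (Ideal.span {ϖ'}) V := Valued.isAdicComplete_span ϖ' fun c hc => by
    obtain ⟨l, hl⟩ := A.exists_valuation_eq c
    have hl0 : l ≠ 0 := by
      rintro rfl
      rw [map_zero, Valuation.zero_iff] at hl
      exact hc hl
    rcases A.mem_or_inv_mem l with hlA | hlA
    · obtain ⟨n, hn⟩ := IsDiscreteValuationRing.associated_pow_irreducible (x := (⟨l, hlA⟩ : A))
        (fun h => hl0 (congrArg Subtype.val h)) hϖ
      obtain ⟨u, hu⟩ := hn.symm
      have hu' : (ϖ : L) ^ n * (u : A) = l := congrArg Subtype.val hu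
      refine ⟨n + 1, ?_⟩
      rw [hl, map_pow, hv, ← hu', map_mul, A.valuation_unit, mul_one, map_pow]
      exact pow_lt_pow_right_of_lt_one₀ (by rwa [Valuation.pos_iff]) hϖ1 n.lt_succ_self
    · refine ⟨1, ?_⟩
      rw [pow_one, hv, hl]
      refine hϖ1.trans_le ?_
      have := (A.valuation_le_one_iff _).2 hlA
      rw [map_inv₀] at this
      exact (inv_le_one₀ (by rwa [Valuation.pos_iff])).1 this
  have hm : IsLocalRing.maximalIdeal V = Ideal.span {ϖ'} := by
    refine le_antisymm (fun y hy => ?_) ?_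
    · rw [Valuation.mem_maximalIdeal_valuationSubring_iff] at hy
      obtain ⟨l, hl⟩ := A.exists_valuation_eq (y : A.FieldCompletion)
      rw [hl] at hy
      have hlA : l ∈ A := (A.valuation_le_one_iff _).1 hy.le
      have hlm : (⟨l, hlA⟩ : A) ∈ IsLocalRing.maximalIdeal A := (A.valuation_lt_one_iff _).2 hy
      rw [hϖ.maximalIdeal_eq, Ideal.mem_span_singleton] at hlm
      obtain ⟨a, ha⟩ := hlm
      have ha' : l = ϖ * a := congrArg Subtype.val ha
      have h0 : (ϖ' : A.FieldCompletion) ≠ 0 := (map_ne_zero _).2 hϖ0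
      refine Ideal.mem_span_singleton.2 ⟨⟨y / ϖ', ?_⟩, Subtype.ext ?_⟩
      · rw [Valuation.mem_valuationSubring_iff, map_div₀, hl, hv, ha', map_mul]
        exact div_le_one_of_le₀ (mul_le_of_le_one_right' ((A.valuation_le_one_iff _).2 a.2))
          zero_le
      · exact (mul_div_cancel₀ (y : A.FieldCompletion) h0).symm
    · rw [Ideal.span_singleton_le_iff_mem, Valuation.mem_maximalIdeal_valuationSubring_iff, hv]
      exact hϖ1
  rw [← hm] at this
  refine ⟨fun f hf a h1 h2 => HenselianRing.is_henselian f hf a h1 (h2.map _)⟩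

variable {R K : Type u} [CommRing R] [Field K] [Algebra R K] [IsDomain R]
  [IsDiscreteValuationRing R] [IsFractionRing R K] [Algebra K L] {A}

/-- By density, `L(x)` with the induced valuation has the value group and residue field of `L`. It
is therefore an unramified extension, and trivial by maximality. -/
theorem IsMaximalUnramifiedExtension.mem_range_of_isSeparable
    (h : IsMaximalUnramifiedExtension R K A) (x : A.FieldCompletion)
    (hx : letI := A.toFieldCompletion.toAlgebra; IsSeparable L x) :
    x ∈ A.toFieldCompletion.range := by
  let _ := A.toFieldCompletion.toAlgebra
  let L' := IntermediateField.adjoin L {x}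
  have : Algebra.IsSeparable L L' :=
    (IntermediateField.isSeparable_adjoin_simple_iff_isSeparable ..).2 hx
  let A' : ValuationSubring L' :=
    ((Valued.v (R := A.FieldCompletion)).comap (algebraMap L' A.FieldCompletion)).valuationSubring
  have hA' (y : L') : y ∈ A' ↔ Valued.v (y : A.FieldCompletion) ≤ 1 := .rfl
  have hv (y : L) : Valued.v ((algebraMap L L' y : L') : A.FieldCompletion) = A.valuation y :=
    A.valued_toFieldCompletion y
  have hm (y : A') : y ∈ IsLocalRing.maximalIdeal A' ↔
      Valued.v ((y : L') : A.FieldCompletion) < 1 :=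
    Valuation.mem_maximalIdeal_valuationSubring_iff
  let g : A →+* A' := ((algebraMap L L').comp A.subtype).codRestrict A'.toSubring fun a => by
    change algebraMap L L' a ∈ A'
    rw [hA', hv]
    exact (A.valuation_le_one_iff _).2 a.2
  have hgm (a : A) : g a ∈ IsLocalRing.maximalIdeal A' ↔ a ∈ IsLocalRing.maximalIdeal A := by
    rw [hm, A.valuation_lt_one_iff, ← hv]
    rfl
  have : IsLocalHom g := ⟨fun a ha => by
    by_contra hu
    exact (hgm a).2 hu ha⟩
  have hsurj := h.algebraMap_surjective A' g (fun _ => rfl) ?_ ?_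
  · obtain ⟨l, hl⟩ := hsurj ⟨x, IntermediateField.mem_adjoin_simple_self L x⟩
    exact ⟨l, congrArg Subtype.val hl⟩
  · refine le_antisymm (Ideal.map_le_iff_le_comap.2 fun a ha => (hgm a).2 ha) fun y hy => ?_
    rw [hm] at hy
    obtain ⟨l, hl⟩ := A.exists_valuation_eq ((y : L') : A.FieldCompletion)
    rw [hl] at hy
    have hlA : l ∈ A := (A.valuation_le_one_iff _).1 hy.le
    by_cases hl0 : l = 0
    · rw [hl0, map_zero, Valuation.zero_iff] at hl
      rw [show y = 0 from Subtype.ext (Subtype.ext hl)]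
      exact Ideal.zero_mem _
    · have hyg : y = g ⟨l, hlA⟩ * ⟨y / algebraMap L L' l, by
          rw [hA']
          change Valued.v ((y : L') / (algebraMap L L' l : L') : A.FieldCompletion) ≤ 1
          rw [map_div₀, hl, hv, div_self ((Valuation.ne_zero_iff _).2 hl0)]⟩ :=
        Subtype.ext (mul_div_cancel₀ (y : L') ((map_ne_zero (algebraMap L L')).2 hl0)).symm
      rw [hyg]
      exact Ideal.mul_mem_right _ _ (Ideal.mem_map_of_mem _ ((A.valuation_lt_one_iff _).2 hy))
  · let _ := (IsLocalRing.ResidueField.map g).toAlgebra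
    refine ⟨fun y => ?_⟩
    obtain ⟨y, rfl⟩ := IsLocalRing.residue_surjective y
    obtain ⟨l, hl⟩ := A.exists_valued_sub_lt ((y : L') : A.FieldCompletion) one_ne_zero
    rw [map_one] at hl
    have hlA : l ∈ A := by
      rw [← A.valuation_le_one_iff, ← hv, ← sub_add_cancel ((algebraMap L L' l : L') : A.FieldCompletion)
        ((y : L') : A.FieldCompletion)]
      exact Valuation.map_add_le _ hl.le y.2
    have hy : IsLocalRing.residue A' y =
        algebraMap (IsLocalRing.ResidueField A) _ (IsLocalRing.residue A ⟨l, hlA⟩) := by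
      change _ = IsLocalRing.residue A' (g ⟨l, hlA⟩)
      refine (Ideal.Quotient.eq.2 ?_).symm
      rw [hm]
      exact hl
    rw [hy]
    exact isSeparable_algebraMap _

end Completion

/-! ### Smooth affine charts through field-valued points -/

section Charts

/-- A smooth scheme over an affine base is covered by spectra of smooth algebras. -/
theorem AlgebraicGeometry.Smooth.exists_isOpenImmersion_Spec {X : Scheme.{u}} {C : CommRingCat.{u}}
    (f : X ⟶ Spec C) [Smooth f] (x : X) :
    ∃ (D : CommRingCat.{u}) (φ : C ⟶ D) (i : Spec D ⟶ X), IsOpenImmersion i ∧ φ.hom.Smooth ∧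
      i ≫ f = Spec.map φ ∧ x ∈ Set.range i := by
  obtain ⟨U, hU, hxU, -⟩ := exists_isAffineOpen_mem_and_subset (X := X) (U := ⊤) (x := x) trivial
  refine ⟨Γ(X, U), Spec.preimage (hU.fromSpec ≫ f), hU.fromSpec, inferInstance, ?_,
    (Spec.map_preimage _).symm, by rwa [hU.range_fromSpec]⟩
  rw [← HasRingHomProperty.Spec_iff (P := @Smooth), Spec.map_preimage]
  infer_instance

/-- A point of a smooth `Y`-scheme with values in a field factors through a smooth affine chart over
any given affine `Y`-scheme. -/
theorem AlgebraicGeometry.Smooth.exists_Spec_of_point {X Y : Scheme.{u}} (f : X ⟶ Y) [Smooth f]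
    {C : CommRingCat.{u}} (k : Spec C ⟶ Y) {F : Type u} [Field F] (w : Spec (.of F) ⟶ X)
    (c : C ⟶ .of F) (h : w ≫ f = Spec.map c ≫ k) :
    ∃ (D : CommRingCat.{u}) (φ : C ⟶ D) (i : Spec D ⟶ X) (d : D ⟶ .of F), φ.hom.Smooth ∧
      i ≫ f = Spec.map φ ≫ k ∧ φ ≫ d = c ∧ Spec.map d ≫ i = w := by
  let w' : Spec (.of F) ⟶ pullback f k := pullback.lift w (Spec.map c) h
  let x := w' (IsLocalRing.closedPoint F)
  obtain ⟨D, φ, i, _, hφ, hi, hx⟩ := Smooth.exists_isOpenImmersion_Spec (pullback.snd f k) x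
  have hrange : Set.range w' ⊆ Set.range i := by
    rintro _ ⟨p, rfl⟩
    rwa [Subsingleton.elim p (IsLocalRing.closedPoint F)]
  let d := Spec.preimage (IsOpenImmersion.lift i w' hrange)
  have hd : Spec.map d ≫ i = w' := by
    rw [Spec.map_preimage, IsOpenImmersion.lift_fac]
  refine ⟨D, φ, i ≫ pullback.fst f k, d, hφ, ?_, ?_, ?_⟩
  · rw [Category.assoc, pullback.condition, reassoc_of% hi]
  · apply Spec.map_injective
    rw [Spec.map_comp, ← hi, reassoc_of% hd, pullback.lift_snd]
  · rw [reassoc_of% hd, pullback.lift_fst]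

end Charts

/-! ### Lifting `A`-points along smooth morphisms -/

section Sections

variable {R K : Type u} [CommRing R] [Field K] [Algebra R K] [IsDomain R]
  [IsDiscreteValuationRing R] [IsFractionRing R K]
  {L : Type u} [Field L] [Algebra K L] {A : ValuationSubring L}

theorem IsMaximalUnramifiedExtension.exists_lift_of_smooth
    (h : IsMaximalUnramifiedExtension R K A) {Z N : Scheme.{u}} (q : Z ⟶ N) [Smooth q]
    (y : Spec (.of A) ⟶ N) (hy : y (IsLocalRing.closedPoint A) ∈ Set.range q) :
    ∃ t : Spec (.of A) ⟶ Z, t ≫ q = y := by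
  obtain ⟨z, hz⟩ := hy
  obtain ⟨x, -, hx⟩ := Scheme.Pullback.exists_preimage_pullback z _ hz
  obtain ⟨D, φ, i, _, hφ, hi, ⟨d, rfl⟩⟩ := Smooth.exists_isOpenImmersion_Spec (pullback.snd q y) x
  let _ : Algebra A D := φ.hom.toAlgebra
  have : Algebra.Smooth A D := hφ
  have : d.asIdeal.IsPrime := d.2
  have hd : d.asIdeal.LiesOver (IsLocalRing.maximalIdeal A) := by
    refine ⟨?_⟩
    have h1 : (i ≫ pullback.snd q y) d = IsLocalRing.closedPoint A := hx
    rw [hi] at h1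
    exact (congrArg PrimeSpectrum.asIdeal h1).symm
  obtain ⟨σ⟩ := h.exists_algHom_of_smooth D d.asIdeal
  have hσ : φ ≫ CommRingCat.ofHom σ.toRingHom = 𝟙 _ := CommRingCat.hom_ext σ.comp_algebraMap
  refine ⟨Spec.map (CommRingCat.ofHom σ.toRingHom) ≫ i ≫ pullback.fst q y, ?_⟩
  rw [Category.assoc, Category.assoc, pullback.condition, reassoc_of% hi, ← Spec.map_comp_assoc, hσ,
    Spec.map_id, Category.id_comp]

end Sections

/-! ### Descending smooth algebras from a localization -/

section SmoothDescent

open TensorProduct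

/-- A smooth algebra over a localization of `B` comes from a smooth `B`-algebra. -/
theorem Algebra.Smooth.exists_smooth_of_isLocalization {B BM C : Type u} [CommRing B] [CommRing BM]
    [CommRing C] (M : Submonoid B) (hM : M ≤ nonZeroDivisors B) [Algebra B BM] [IsLocalization M BM]
    [Algebra BM C] [Algebra.Smooth BM C] :
    ∃ (C' : Type u) (_ : CommRing C') (α : B →+* C') (γ : C' →+* C), α.Smooth ∧
      γ.comp α = (algebraMap BM C).comp (algebraMap B BM) ∧
      ∀ (T : Type u) [CommRing T] (s : BM →+* T) (t : C' →+* T),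
        t.comp α = s.comp (algebraMap B BM) → ∃ w : C →+* T, w.comp (algebraMap BM C) = s := by
  obtain ⟨A₀, B₀, _, _, ⟨G, hG⟩, _, ⟨e⟩⟩ := Algebra.Smooth.exists_subalgebra_fg B BM C
  -- A common denominator `b` of the generators puts `A₀` inside `B[1/b]`.
  obtain ⟨b, hb⟩ := IsLocalization.exist_integer_multiples_of_finset M G
  let Bb := Localization.Away (b : B)
  have hbu : IsUnit (algebraMap B BM b) := IsLocalization.map_units BM b
  let τ : Bb →ₐ[B] BM := IsLocalization.Away.liftAlgHom (b : B) (f := Algebra.ofId B BM) hbu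
  have hinj : Function.Injective τ := by
    refine (IsLocalization.lift_injective_iff _).2 fun x y => ?_
    rw [(IsLocalization.injective Bb ((Submonoid.powers_le).2 (hM b.2))).eq_iff]
    exact (IsLocalization.injective BM hM).eq_iff.symm
  have hle : A₀ ≤ τ.range := by
    rw [← hG, Algebra.adjoin_le_iff]
    intro g hg
    obtain ⟨x, hx⟩ := hb g hg
    refine ⟨IsLocalization.Away.invSelf (b : B) * algebraMap B Bb x, hbu.mul_left_cancel ?_⟩
    have h1 : algebraMap B BM b = τ (algebraMap B Bb b) := (τ.commutes _).symm
    change algebraMap B BM b * τ _ = _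
    rw [map_mul, ← mul_assoc, h1, ← map_mul, IsLocalization.Away.mul_invSelf,
      map_one, one_mul, τ.commutes, hx, ← h1, Algebra.smul_def]
  let ρ : A₀ →ₐ[B] Bb :=
    (AlgEquiv.ofInjective τ hinj).symm.toAlgHom.comp (Subalgebra.inclusion hle)
  have hρ (a : A₀) : τ (ρ a) = a :=
    congrArg Subtype.val ((AlgEquiv.ofInjective τ hinj).apply_symm_apply _)
  let _ : Algebra A₀ Bb := ρ.toAlgebra
  -- `C` is the base change of `B₀` to `BM`. A map from `C'` restricts to `B₀`, and combines with a
  -- compatible map from `BM` to give one from `C`.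
  let C' := Bb ⊗[A₀] B₀
  let α : B →+* C' := (algebraMap Bb C').comp (algebraMap B Bb)
  have hsq (T : Type u) [CommRing T] (s : BM →+* T) (t : C' →+* T)
      (h : t.comp α = s.comp (algebraMap B BM)) :
      t.comp (algebraMap Bb C') = s.comp τ := by
    refine IsLocalization.ringHom_ext (.powers (b : B)) ?_
    rw [RingHom.comp_assoc, h, RingHom.comp_assoc]
    exact congrArg _ (τ.comp_algebraMap).symm
  let τ' : Bb →ₐ[A₀] BM := AlgHom.mk τ.toRingHom hρ
  let γ₀ : C' →ₐ[A₀] BM ⊗[A₀] B₀ := Algebra.TensorProduct.map τ' (.id A₀ B₀)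
  refine ⟨C', inferInstance, α, e.symm.toRingHom.comp γ₀, ?_, RingHom.ext fun x => ?_,
    fun T _ s t h => ?_⟩
  · exact ((RingHom.smooth_algebraMap).2 (Algebra.Smooth.of_isLocalization_Away (b : B))).comp
      ((RingHom.smooth_algebraMap).2 inferInstance)
  · change e.symm (γ₀ (algebraMap B Bb x ⊗ₜ 1)) = _
    have h1 : γ₀ (algebraMap B Bb x ⊗ₜ 1) = τ (algebraMap B Bb x) ⊗ₜ 1 :=
      (Algebra.TensorProduct.map_tmul ..).trans (by rw [map_one]; rfl)
    rw [h1, τ.commutes]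
    exact e.symm.commutes _
  · let _ : Algebra A₀ T := (s.comp A₀.val.toRingHom).toAlgebra
    let s' : BM →ₐ[A₀] T := AlgHom.mk s fun a => rfl
    let t' : B₀ →ₐ[A₀] T := AlgHom.mk (t.comp Algebra.TensorProduct.includeRight.toRingHom) fun a => by
      change t (1 ⊗ₜ algebraMap A₀ B₀ a) = s a
      rw [← hρ a, ← Algebra.TensorProduct.tmul_one_eq_one_tmul]
      exact congr($(hsq T s t h) (ρ a))
    refine ⟨(Algebra.TensorProduct.productMap s' t').toRingHom.comp e.toRingHom,
      RingHom.ext fun x => ?_⟩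
    change Algebra.TensorProduct.productMap s' t' (e (algebraMap BM C x)) = s x
    rw [e.commutes]
    exact Algebra.TensorProduct.productMap_left_apply ..

end SmoothDescent

/-! ### Spreading out smooth covers from the generic fibre -/

section Spreading

/-- A smooth surjective morphism to the generic fibre of a smooth `S`-scheme `N` can be lifted along
a smooth `N`-scheme near any given point of the generic fibre. -/
theorem AlgebraicGeometry.Smooth.exists_spreading_out {S N H G : Scheme.{u}} [IsIntegral S]
    (n : N ⟶ S) [Smooth n] (p : H ⟶ Spec S.functionField) (j : H ⟶ N)
    (hj : IsPullback j p n (S.fromSpecStalk (genericPoint S))) (f : G ⟶ H) [Smooth f]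
    [Surjective f] (y : H) :
    ∃ (Z : CommRingCat.{u}) (q : Spec Z ⟶ N), Smooth q ∧ j y ∈ Set.range q ∧
      ∀ (T : CommRingCat.{u}) (t : Spec T ⟶ Spec Z) (h : Spec T ⟶ H), t ≫ q = h ≫ j →
        ∃ g : Spec T ⟶ G, g ≫ f = h := by
  obtain ⟨U, hU, hyU, -⟩ := exists_isAffineOpen_mem_and_subset (X := S) (U := ⊤) (x := n (j y))
    trivial
  obtain ⟨V, hV, hyV, hVU⟩ := exists_isAffineOpen_mem_and_subset (X := N) (U := n ⁻¹ᵁ U) (x := j y)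
    hyU
  have : Nonempty U := ⟨⟨_, hyU⟩⟩
  have hηU : genericPoint S ∈ U := ((genericPoint_spec S).mem_open_set_iff U.isOpen).2
    ⟨_, trivial, hyU⟩
  let R₀ := Γ(S, U)
  let B := Γ(N, V)
  let β : R₀ ⟶ B := n.appLE U V hVU
  let κ : R₀ ⟶ S.functionField := S.presheaf.germ U _ hηU
  let _ : Algebra R₀ B := β.hom.toAlgebra
  have : IsFractionRing R₀ S.functionField := functionField_isFractionRing_of_isAffineOpen S U hU
  have hκ : algebraMap R₀ S.functionField = κ.hom := rfl
  have hβ : hV.fromSpec ≫ n = Spec.map β ≫ hU.fromSpec :=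
    (IsAffineOpen.SpecMap_appLE_fromSpec n hU hV hVU).symm
  have hη : S.fromSpecStalk (genericPoint S) = Spec.map κ ≫ hU.fromSpec :=
    (hU.fromSpecStalk_eq_fromSpecStalk hηU).symm
  have : Algebra.Smooth R₀ B := HasRingHomProperty.appLE @Smooth n ‹_› ⟨U, hU⟩ ⟨V, hV⟩ hVU
  have : Module.Flat R₀ B := inferInstance
  let M := Algebra.algebraMapSubmonoid B (nonZeroDivisors R₀)
  -- Flatness over `R₀` keeps nonzero elements of `R₀` regular in `B`, as clearing denominators
  -- requires.
  have hM : M ≤ nonZeroDivisors B := by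
    rintro _ ⟨r, hr, rfl⟩
    refine mem_nonZeroDivisors_iff_right.2 fun b hb => ?_
    rw [mul_comm, ← Algebra.smul_def] at hb
    exact (smul_eq_zero_iff_right (nonZeroDivisors.ne_zero hr)).1 hb
  let BM : CommRingCat.{u} := .of (Localization M)
  let bM : B ⟶ BM := CommRingCat.ofHom (algebraMap B (Localization M))
  have huM (r : nonZeroDivisors R₀) : IsUnit ((β ≫ bM).hom r) :=
    IsLocalization.map_units (Localization M) (⟨_, r, r.2, rfl⟩ : M)
  let kM : S.functionField ⟶ BM := CommRingCat.ofHom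
    (IsLocalization.lift (S := S.functionField) huM)
  have hbM : β ≫ bM = κ ≫ kM := CommRingCat.hom_ext (IsLocalization.lift_comp huM).symm
  have hlift (T : CommRingCat.{u}) (b : B ⟶ T) (k : S.functionField ⟶ T) (hbk : β ≫ b = κ ≫ k) :
      ∃ s : BM ⟶ T, bM ≫ s = b ∧ kM ≫ s = k := by
    have hu (m : M) : IsUnit (b.hom m) := by
      obtain ⟨_, r, hr, rfl⟩ := m
      have h1 : b.hom (algebraMap R₀ B r) = k.hom (algebraMap R₀ S.functionField r) :=
        congr($(hbk).hom r)
      rw [h1]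
      exact (IsLocalization.map_units S.functionField (⟨r, hr⟩ : nonZeroDivisors R₀)).map _
    let s : BM ⟶ T := CommRingCat.ofHom (IsLocalization.lift hu)
    have hs : bM ≫ s = b := CommRingCat.hom_ext (IsLocalization.lift_comp hu)
    refine ⟨s, hs, CommRingCat.hom_ext ?_⟩
    refine IsLocalization.ringHom_ext (nonZeroDivisors R₀) ?_
    have h2 : κ ≫ kM ≫ s = κ ≫ k := by
      rw [← hbk, ← hs, ← Category.assoc, ← hbM, Category.assoc]
    exact congrArg CommRingCat.Hom.hom h2
  -- `Spec BM` is the part of `H` lying over `V`; `hθ` is the resulting factorization of points.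
  let θ : Spec BM ⟶ H := hj.lift (Spec.map bM ≫ hV.fromSpec) (Spec.map kM) (by
    rw [Category.assoc, hβ, hη, ← Spec.map_comp_assoc, hbM, Spec.map_comp_assoc])
  have hθ (T : CommRingCat.{u}) (h : Spec T ⟶ H) (b : B ⟶ T)
      (hb : Spec.map b ≫ hV.fromSpec = h ≫ j) :
      ∃ s : BM ⟶ T, bM ≫ s = b ∧ Spec.map s ≫ θ = h := by
    obtain ⟨s, hs, hs'⟩ := hlift T b (Spec.preimage (h ≫ p)) (by
      apply Spec.map_injective
      rw [← cancel_mono hU.fromSpec, Spec.map_comp, Category.assoc, ← hβ, reassoc_of% hb,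
        hj.w, Spec.map_comp, Spec.map_preimage, hη, Category.assoc, Category.assoc])
    refine ⟨s, hs, hj.hom_ext ?_ ?_⟩
    · rw [Category.assoc, hj.lift_fst, ← Spec.map_comp_assoc, hs, hb]
    · rw [Category.assoc, hj.lift_snd, ← Spec.map_comp, hs', Spec.map_preimage]
  obtain ⟨g₀, hg₀⟩ := f.surjective y
  let w := G.fromSpecResidueField g₀
  obtain ⟨pt⟩ : Nonempty (Spec (G.residueField g₀)) := inferInstance
  have hw : (w ≫ f) pt = y := by
    have : w pt ∈ Set.range w := ⟨_, rfl⟩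
    rw [Scheme.range_fromSpecResidueField, Set.mem_singleton_iff] at this
    rw [Scheme.Hom.comp_apply, this, hg₀]
  have hwV : Set.range ((w ≫ f) ≫ j) ⊆ Set.range hV.fromSpec := by
    rintro _ ⟨x, rfl⟩
    rw [hV.range_fromSpec, Subsingleton.elim x pt,
      Scheme.Hom.comp_apply, hw]
    exact hyV
  obtain ⟨c, hbc, hc⟩ := hθ (G.residueField g₀) (w ≫ f)
    (Spec.preimage (IsOpenImmersion.lift hV.fromSpec _ hwV)) (by
      rw [Spec.map_preimage, IsOpenImmersion.lift_fac])
  obtain ⟨C, φ, i, d, hφ, hi, hd, hdi⟩ := Smooth.exists_Spec_of_point f θ w c hc.symm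
  let _ : Algebra (Localization M) C := φ.hom.toAlgebra
  have : Algebra.Smooth (Localization M) C := hφ
  obtain ⟨C', _, α, γ, hα, hγ, huniv⟩ :=
    Algebra.Smooth.exists_smooth_of_isLocalization (BM := Localization M) (C := C) M hM
  let α' : B ⟶ .of C' := CommRingCat.ofHom α
  let γ' : .of C' ⟶ C := CommRingCat.ofHom γ
  have hγ' : α' ≫ γ' = bM ≫ φ := CommRingCat.hom_ext hγ
  have : Smooth (Spec.map α') := (HasRingHomProperty.Spec_iff (P := @Smooth)).2 hα
  refine ⟨.of C', Spec.map α' ≫ hV.fromSpec, inferInstance, ?_, fun T t h hth => ?_⟩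
  · have heq : Spec.map (γ' ≫ d) ≫ Spec.map α' ≫ hV.fromSpec = (w ≫ f) ≫ j := by
      rw [← Spec.map_comp_assoc, reassoc_of% hγ', hd]
      have h1 : Spec.map (bM ≫ c) = IsOpenImmersion.lift hV.fromSpec _ hwV :=
        (congrArg Spec.map hbc).trans (Spec.map_preimage _)
      exact (congrArg (· ≫ hV.fromSpec) h1).trans (IsOpenImmersion.lift_fac ..)
    exact ⟨Spec.map (γ' ≫ d) pt, congr($heq pt).trans (congrArg j hw)⟩
  -- Since the point also comes from `H`, it is defined on `BM`; `huniv` then turns the `C'`-point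
  -- into a point of the chart `Spec C` of `G`.
  · obtain ⟨s, hs, hsθ⟩ := hθ T h (α' ≫ Spec.preimage t) (by
      rw [Spec.map_comp, Spec.map_preimage, Category.assoc, hth])
    obtain ⟨v, hv⟩ := huniv T s.hom (Spec.preimage t).hom (congrArg CommRingCat.Hom.hom hs.symm)
    refine ⟨Spec.map (CommRingCat.ofHom v) ≫ i, ?_⟩
    have hv' : φ ≫ CommRingCat.ofHom v = s := CommRingCat.hom_ext hv
    rw [Category.assoc, hi, ← Spec.map_comp_assoc, hv', hsθ]

end Spreading

/-! ### Points of Dedekind schemes -/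

section DedekindScheme

open Topology

/-- A further point in the closure of `p` would give, with `p` and `η`, a chain of irreducible
closed sets of length two. -/
theorem isClosed_singleton_of_topologicalKrullDim_le_one {X : Type*} [TopologicalSpace X] [T0Space X]
    (hX : topologicalKrullDim X ≤ 1) {η p : X} (hη : IsGenericPoint η Set.univ) (hp : p ≠ η) :
    IsClosed {p} := by
  rw [← closure_subset_iff_isClosed]
  intro s hs
  by_contra hsp
  let c (x : X) : TopologicalSpace.IrreducibleCloseds X :=
    ⟨closure {x}, isIrreducible_singleton.closure, isClosed_closure⟩
  have hlt (x y : X) (hxy : x ∈ closure {y}) (hne : x ≠ y) : c x < c y := by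
    refine lt_of_le_of_ne (closure_minimal (Set.singleton_subset_iff.2 hxy) isClosed_closure)
      fun h => hne ?_
    have h' : closure {x} = closure {y} := congrArg TopologicalSpace.IrreducibleCloseds.carrier h
    exact (inseparable_iff_closure_eq.2 h').eq
  let l : LTSeries (TopologicalSpace.IrreducibleCloseds X) :=
    { length := 2
      toFun := ![c s, c p, c η]
      step := by
        intro i
        fin_cases i
        · exact hlt s p hs hsp
        · exact hlt p η (hη.symm ▸ Set.mem_univ p) hp }
  have h2 : ((2 : ℕ) : WithBot ℕ∞) ≤ 1 := (Order.LTSeries.length_le_krullDim l).trans hX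
  norm_cast at h2

/-- Each of the finitely many irreducible components of the complement has a generic point with
closed image. The component lies in the closed preimage of that image, so it maps to a single point.
-/
theorem TopologicalSpace.NoetherianSpace.finite_image_compl {X Y : Type*} [TopologicalSpace X]
    [TopologicalSpace.NoetherianSpace X] [QuasiSober X] [TopologicalSpace Y] {n : X → Y}
    (hn : Continuous n) {W : Set X} (hW : IsOpen W) (hc : ∀ x ∉ W, IsClosed {n x}) :
    (n '' Wᶜ).Finite := by
  obtain ⟨T, hT, hTc, hTi, hTW⟩ :=
    NoetherianSpace.exists_finite_set_isClosed_irreducible hW.isClosed_compl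
  rw [hTW, Set.sUnion_eq_biUnion, Set.image_iUnion₂]
  refine hT.biUnion fun t ht => Set.Subsingleton.finite ?_
  obtain ⟨z, hz⟩ := QuasiSober.sober (hTi t ht) (hTc t ht)
  have hzW : z ∉ W := by
    have : z ∈ Wᶜ := hTW ▸ Set.mem_sUnion_of_mem hz.mem ht
    exact this
  have hsub : t ⊆ n ⁻¹' {n z} := by
    rw [← hz.def]
    exact closure_minimal (Set.singleton_subset_iff.2 rfl) ((hc z hzW).preimage hn)
  exact Set.subsingleton_singleton.anti (Set.image_subset_iff.2 hsub)

theorem AlgebraicGeometry.IsAffineOpen.asIdeal_eq_bot_of_fromSpec_eq_genericPoint {S : Scheme.{u}}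
    [IsIntegral S] {U : S.Opens} (hU : IsAffineOpen U) [Nonempty U] {y : PrimeSpectrum Γ(S, U)}
    (h : hU.fromSpec y = genericPoint S) : y.asIdeal = ⊥ := by
  let b : PrimeSpectrum Γ(S, U) := ⟨⊥, inferInstance⟩
  have hby : b ⤳ y := (PrimeSpectrum.le_iff_specializes b y).1 bot_le
  have h1 : hU.fromSpec b ⤳ hU.fromSpec y := hby.map hU.fromSpec.continuous
  rw [h] at h1
  have h2 : hU.fromSpec b = hU.fromSpec y :=
    (h1.antisymm (genericPoint_specializes _)).eq.trans h.symm
  exact (congrArg PrimeSpectrum.asIdeal (hU.fromSpec.isOpenEmbedding.injective h2)).symm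

variable (S : Scheme.{u}) [IsDedekindScheme S]

theorem IsDedekindScheme.isClosed_singleton {s : S} (hs : s ≠ genericPoint S) : IsClosed {s} :=
  isClosed_singleton_of_topologicalKrullDim_le_one IsDedekindScheme.krullDim_le_one
    (genericPoint_spec S) hs

theorem IsDedekindScheme.isDedekindDomain {U : S.Opens} (hU : IsAffineOpen U) [Nonempty U] :
    IsDedekindDomain Γ(S, U) := by
  have h1 : IsNoetherianRing Γ(S, U) := IsLocallyNoetherian.component_noetherian ⟨U, hU⟩
  have h2 : IsIntegrallyClosed Γ(S, U) := by
    refine IsIntegrallyClosed.of_localization_maximal fun p _ hp => ?_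
    let y : PrimeSpectrum Γ(S, U) := ⟨p, inferInstance⟩
    have hy : hU.fromSpec y ∈ U := hU.range_fromSpec.subset ⟨y, rfl⟩
    let _ := TopCat.Presheaf.algebra_section_stalk S.presheaf ⟨hU.fromSpec y, hy⟩
    have : IsLocalization.AtPrime (S.presheaf.stalk (hU.fromSpec y)) p :=
      hU.isLocalization_stalk' y hy
    have := IsDedekindScheme.isIntegrallyClosed_stalk (hU.fromSpec y)
    exact .of_equiv (IsLocalization.algEquiv p.primeCompl (S.presheaf.stalk (hU.fromSpec y))
      (Localization.AtPrime p)).toRingEquiv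
  have h3 : Ring.DimensionLEOne Γ(S, U) := by
    refine ⟨fun {p} hp0 hp => ?_⟩
    let y : PrimeSpectrum Γ(S, U) := ⟨p, hp⟩
    have hyη : hU.fromSpec y ≠ genericPoint S := fun h =>
      hp0 (hU.asIdeal_eq_bot_of_fromSpec_eq_genericPoint h)
    have h5 : IsClosed {y} := by
      have := (IsDedekindScheme.isClosed_singleton S hyη).preimage hU.fromSpec.continuous
      convert! this
      exact Set.ext fun _ => hU.fromSpec.isOpenEmbedding.injective.eq_iff.symm
    exact (PrimeSpectrum.isClosed_singleton_iff_isMaximal y).1 h5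
  exact { h1, h3, h2 with }

theorem IsDedekindScheme.isDiscreteValuationRing_stalk {s : S} (hs : s ≠ genericPoint S) :
    IsDiscreteValuationRing (S.presheaf.stalk s) := by
  obtain ⟨U, hU, hsU, -⟩ := exists_isAffineOpen_mem_and_subset (X := S) (U := ⊤) (x := s) trivial
  have : Nonempty U := ⟨⟨s, hsU⟩⟩
  have := IsDedekindScheme.isDedekindDomain S hU
  let _ := TopCat.Presheaf.algebra_section_stalk S.presheaf ⟨s, hsU⟩
  have := hU.isLocalization_stalk ⟨s, hsU⟩
  refine IsLocalization.AtPrime.isDiscreteValuationRing_of_dedekind_domain Γ(S, U)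
    (P := (hU.primeIdealOf ⟨s, hsU⟩).asIdeal) (fun h => hs ?_) _
  have hη : genericPoint S ∈ U := ((genericPoint_spec S).mem_open_set_iff U.isOpen).2
    ⟨s, trivial, hsU⟩
  have h1 := hU.asIdeal_eq_bot_of_fromSpec_eq_genericPoint
    (hU.fromSpec_primeIdealOf ⟨genericPoint S, hη⟩)
  have h2 : hU.primeIdealOf ⟨s, hsU⟩ = hU.primeIdealOf ⟨genericPoint S, hη⟩ :=
    PrimeSpectrum.ext (h.trans h1.symm)
  have h3 := congrArg hU.fromSpec h2
  rwa [hU.fromSpec_primeIdealOf, hU.fromSpec_primeIdealOf] at h3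

end DedekindScheme

/-! ### Extending unramified points to the Néron model -/

section NeronExtension

/-- A point with values in an algebraic extension of a scheme locally of finite type over a field
is defined over a finite subextension. -/
theorem AlgebraicGeometry.LocallyOfFiniteType.exists_finiteDimensional_factor {K L : Type u}
    [Field K] [Field L] [Algebra K L] [Algebra.IsAlgebraic K L] {X : Scheme.{u}}
    (p : X ⟶ Spec (.of K)) [LocallyOfFiniteType p] (x : Spec (.of L) ⟶ X)
    (hx : x ≫ p = Spec.map (CommRingCat.ofHom (algebraMap K L))) :
    ∃ F : IntermediateField K L, FiniteDimensional K F ∧ ∃ x' : Spec (.of F) ⟶ X,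
      x' ≫ p = Spec.map (CommRingCat.ofHom (algebraMap K F)) ∧
      Spec.map (CommRingCat.ofHom (algebraMap F L)) ≫ x' = x := by
  obtain ⟨pt⟩ : Nonempty (Spec (.of L)) := inferInstance
  obtain ⟨V, hV, hxV, -⟩ := exists_isAffineOpen_mem_and_subset (X := X) (U := ⊤) (x := x pt)
    trivial
  have hr : Set.range x ⊆ Set.range hV.fromSpec := by
    rintro _ ⟨z, rfl⟩
    rw [hV.range_fromSpec, Subsingleton.elim z pt]
    exact hxV
  let b : Γ(X, V) ⟶ .of L := Spec.preimage (IsOpenImmersion.lift hV.fromSpec x hr)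
  have hb : Spec.map b ≫ hV.fromSpec = x := by
    rw [Spec.map_preimage, IsOpenImmersion.lift_fac]
  let κ : .of K ⟶ Γ(X, V) := Spec.preimage (hV.fromSpec ≫ p)
  have hκ : Spec.map κ = hV.fromSpec ≫ p := Spec.map_preimage _
  have hκb : κ ≫ b = CommRingCat.ofHom (algebraMap K L) := by
    apply Spec.map_injective
    rw [Spec.map_comp, hκ, reassoc_of% hb, hx]
  have hft : κ.hom.FiniteType := by
    have : LocallyOfFiniteType (Spec.map κ) := hκ ▸ inferInstance
    exact (HasRingHomProperty.Spec_iff (P := @LocallyOfFiniteType)).1 this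
  let _ : Algebra K Γ(X, V) := κ.hom.toAlgebra
  have : Algebra.FiniteType K Γ(X, V) := hft
  obtain ⟨s, hs⟩ := this
  let bA : Γ(X, V) →ₐ[K] L := ⟨b.hom, fun r => congr($(hκb).hom r)⟩
  let F : IntermediateField K L := IntermediateField.adjoin K (bA '' s)
  have hF : FiniteDimensional K F := by
    have : Finite (bA '' (s : Set Γ(X, V))) := (s.finite_toSet.image _).to_subtype
    exact IntermediateField.finiteDimensional_adjoin fun x _ =>
      (Algebra.IsAlgebraic.isAlgebraic (R := K) x).isIntegral
  have hbF (z) : bA z ∈ F.toSubalgebra := by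
    have h1 : Algebra.adjoin K (s : Set Γ(X, V)) ≤ F.toSubalgebra.comap bA :=
      Algebra.adjoin_le fun y hy => IntermediateField.subset_adjoin K _ ⟨y, hy, rfl⟩
    rw [hs] at h1
    exact h1 (Algebra.mem_top (x := z))
  let b' : Γ(X, V) →ₐ[K] F := bA.codRestrict F.toSubalgebra hbF
  refine ⟨F, hF, Spec.map (CommRingCat.ofHom b'.toRingHom) ≫ hV.fromSpec, ?_, ?_⟩
  · rw [Category.assoc, ← hκ, ← Spec.map_comp]
    congr 1
    exact CommRingCat.hom_ext b'.comp_algebraMap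
  · rw [← Spec.map_comp_assoc, ← hb]
    rfl

/-- Base change along a morphism to an open subscheme is the same as base change along the composite
to the whole scheme. -/
theorem CategoryTheory.IsPullback.comp_mono {C : Type*} [Category* C] {P X Y Z W : C}
    {a : P ⟶ X} {b : P ⟶ Y} {f : X ⟶ Z} {g : Y ⟶ Z} (h : IsPullback a b f g) (i : Z ⟶ W)
    [Mono i] : IsPullback a b (f ≫ i) (g ≫ i) :=
  ⟨⟨by rw [reassoc_of% h.w]⟩, ⟨PullbackCone.isLimitOfCompMono f g i _ h.isLimit⟩⟩

variable {S : Scheme.{u}} [IsIntegral S]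

/-- The morphism from the generic fibre of an `S`-scheme to the scheme. -/
noncomputable abbrev IsNeronModel.fromGenericFibre {H : Over (Spec S.functionField)} {N : Over S}
    (e : (genericFibre S).obj N ≅ H) : H.left ⟶ N.left :=
  e.inv.left ≫ pullback.fst N.hom (S.fromSpecStalk (genericPoint S))

theorem IsNeronModel.isPullback_fromGenericFibre {H : Over (Spec S.functionField)} {N : Over S}
    (e : (genericFibre S).obj N ≅ H) :
    IsPullback (IsNeronModel.fromGenericFibre e) H.hom N.hom
      (S.fromSpecStalk (genericPoint S)) := by
  refine (IsPullback.of_hasPullback N.hom (S.fromSpecStalk (genericPoint S))).of_iso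
    ((Over.forget _).mapIso e) (Iso.refl _) (Iso.refl _) (Iso.refl _) ?_ ?_ ?_ ?_
  · change _ = e.hom.left ≫ e.inv.left ≫ _
    rw [← Over.comp_left_assoc, e.hom_inv_id]
    simp
  · simp
  · simp
  · simp

/-- The Néron mapping property, for an arbitrary pullback square exhibiting the generic fibre. -/
theorem IsNeronModel.exists_extension {H : Over (Spec S.functionField)} [GrpObj H] {N : Over S}
    [GrpObj N] {e : (genericFibre S).obj N ≅ H} (hN : IsNeronModel H N e) {T T' : Scheme.{u}}
    (t : T ⟶ S) [Smooth t] (a : T' ⟶ T) (p : T' ⟶ Spec S.functionField)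
    (hT : IsPullback a p t (S.fromSpecStalk (genericPoint S))) (φ : T' ⟶ H.left)
    (hφ : φ ≫ H.hom = p) :
    ∃ ψ : T ⟶ N.left, ψ ≫ N.hom = t ∧ a ≫ ψ = φ ≫ IsNeronModel.fromGenericFibre e := by
  let φ' : (genericFibre S).obj (Over.mk t) ⟶ H := Over.homMk (hT.isoPullback.inv ≫ φ) (by
    rw [Category.assoc, hφ]
    exact hT.isoPullback_inv_snd)
  obtain ⟨ψ, hψ, -⟩ := hN.existsUnique_extension (Over.mk t) ‹_› φ'
  refine ⟨ψ.left, Over.w ψ, ?_⟩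
  have h1 : ((genericFibre S).map ψ).left ≫ pullback.fst N.hom _ =
      pullback.fst t _ ≫ ψ.left := pullback.lift_fst ..
  have h2 : (genericFibre S).map ψ = φ' ≫ e.inv := by rw [← hψ]; simp
  rw [h2] at h1
  have h3 : hT.isoPullback.hom ≫ φ'.left = φ := by
    change hT.isoPullback.hom ≫ hT.isoPullback.inv ≫ φ = φ
    simp
  rw [← hT.isoPullback_hom_fst, Category.assoc, ← h1, Over.comp_left, Category.assoc,
    reassoc_of% h3]

/-- The mapping property concerns smooth `S`-schemes, whereas `A` is in general only a limit of
such. The point is therefore first descended to a finite subextension, where an étale model is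
available. -/
theorem IsNeronModel.exists_point_of_isUnramifiedExtension {S : Scheme.{u}} [IsDedekindScheme S]
    {H : Over (Spec S.functionField)} [GrpObj H] [LocallyOfFiniteType H.hom] {N : Over S}
    [GrpObj N] {e : (genericFibre S).obj N ≅ H} (hN : IsNeronModel H N e) {s : S}
    (hs : s ≠ genericPoint S) {L : Type u} [Field L] [Algebra S.functionField L]
    {A : ValuationSubring L}
    (hA : IsUnramifiedExtension (S.presheaf.stalk s) S.functionField A)
    (x : Spec (.of L) ⟶ H.left)
    (hx : x ≫ H.hom = Spec.map (CommRingCat.ofHom (algebraMap S.functionField L))) :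
    ∃ y : Spec (.of A) ⟶ N.left,
      y ≫ N.hom = Spec.map (CommRingCat.ofHom hA.extendsRing.ringHom) ≫ S.fromSpecStalk s ∧
      Spec.map (CommRingCat.ofHom A.subtype) ≫ y = x ≫ IsNeronModel.fromGenericFibre e := by
  have := hA.isSeparable
  obtain ⟨F, hF, x', hx', hxx'⟩ :=
    LocallyOfFiniteType.exists_finiteDimensional_factor (K := S.functionField) H.hom x hx
  obtain ⟨U, hU, hsU, -⟩ := exists_isAffineOpen_mem_and_subset (X := S) (U := ⊤) (x := s) trivial
  have : Nonempty U := ⟨⟨s, hsU⟩⟩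
  have hηU : genericPoint S ∈ U := ((genericPoint_spec S).mem_open_set_iff U.isOpen).2
    ⟨_, trivial, hsU⟩
  have := IsDedekindScheme.isDedekindDomain S hU
  have := IsDedekindScheme.isDiscreteValuationRing_stalk S hs
  let _ := TopCat.Presheaf.algebra_section_stalk S.presheaf ⟨s, hsU⟩
  have := hU.isLocalization_stalk ⟨s, hsU⟩
  have : IsFractionRing Γ(S, U) S.functionField := functionField_isFractionRing_of_isAffineOpen S U hU
  have := functionField_isScalarTower S U ⟨s, hsU⟩
  let _ : Algebra Γ(S, U) F := ((algebraMap S.functionField F).comp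
    (algebraMap Γ(S, U) S.functionField)).toAlgebra
  have : IsScalarTower Γ(S, U) S.functionField F := .of_algebraMap_eq' rfl
  obtain ⟨E, _, _, _, _, hE, hpo, hEA⟩ := hA.exists_etale (R₀ := Γ(S, U))
    (hU.primeIdealOf ⟨s, hsU⟩).asIdeal F
  have hsq := (isPullback_SpecMap_of_isPushout _ _ _ _
    (CommRingCat.isPushout_of_isPushout Γ(S, U) S.functionField E F)).flip.comp_mono hU.fromSpec
  have hη : Spec.map (CommRingCat.ofHom (algebraMap Γ(S, U) S.functionField)) ≫ hU.fromSpec =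
      S.fromSpecStalk (genericPoint S) := hU.fromSpecStalk_eq_fromSpecStalk hηU
  have hss : Spec.map (CommRingCat.ofHom (algebraMap Γ(S, U) (S.presheaf.stalk s))) ≫ hU.fromSpec =
      S.fromSpecStalk s := hU.fromSpecStalk_eq_fromSpecStalk hsU
  rw [hη] at hsq
  have : Smooth (Spec.map (CommRingCat.ofHom (algebraMap Γ(S, U) E))) :=
    (HasRingHomProperty.Spec_iff (P := @Smooth)).2 (by
      have : Algebra.Smooth Γ(S, U) E := inferInstance
      exact RingHom.smooth_algebraMap.2 this)
  obtain ⟨ψ, hψ, hψ'⟩ := hN.exists_extension _ _ _ hsq x' hx'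
  let ε : E →+* A := ((algebraMap F L).comp (algebraMap E F)).codRestrict A.toSubring hEA
  refine ⟨Spec.map (CommRingCat.ofHom ε) ≫ ψ, ?_, ?_⟩
  · rw [Category.assoc, hψ, ← hss, ← Spec.map_comp_assoc, ← Spec.map_comp_assoc]
    congr 2
    ext r
    change algebraMap F L (algebraMap E F (algebraMap Γ(S, U) E r)) =
      algebraMap S.functionField L (algebraMap (S.presheaf.stalk s) S.functionField
        (algebraMap Γ(S, U) (S.presheaf.stalk s) r))
    rw [← IsScalarTower.algebraMap_apply Γ(S, U) E F, ← IsScalarTower.algebraMap_apply Γ(S, U)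
      (S.presheaf.stalk s), IsScalarTower.algebraMap_apply Γ(S, U) S.functionField F,
      ← IsScalarTower.algebraMap_apply S.functionField F L]
  · rw [← hxx', Category.assoc, ← hψ', ← Spec.map_comp_assoc, ← Spec.map_comp_assoc]
    rfl

end NeronExtension

/-! ### From points over `L` to points over the completion -/

section CompletionPoints

/-- A field-valued point of a smooth `K`-scheme factors through an affine scheme étale over
an affine space. -/
theorem AlgebraicGeometry.Smooth.exists_etale_mvPolynomial_of_point {K F : Type u} [Field K]
    [Field F] [Algebra K F] {X : Scheme.{u}} (p : X ⟶ Spec (.of K)) [Smooth p]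
    (x : Spec (.of F) ⟶ X)
    (hx : x ≫ p = Spec.map (CommRingCat.ofHom (algebraMap K F))) :
    ∃ (n : ℕ) (B : Type u) (_ : CommRing B) (_ : Algebra K B)
      (_ : Algebra (MvPolynomial (Fin n) K) B) (i : Spec (.of B) ⟶ X) (δ : B →ₐ[K] F),
      IsScalarTower K (MvPolynomial (Fin n) K) B ∧ Algebra.Etale (MvPolynomial (Fin n) K) B ∧
      i ≫ p = Spec.map (CommRingCat.ofHom (algebraMap K B)) ∧
      Spec.map (CommRingCat.ofHom δ.toRingHom) ≫ i = x := by
  obtain ⟨B₀, φ, i, d, hφ, hi, hd, hdi⟩ := Smooth.exists_Spec_of_point p (𝟙 _) x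
    (CommRingCat.ofHom (algebraMap K F)) (by rw [hx, Category.comp_id])
  let _ : Algebra K B₀ := φ.hom.toAlgebra
  have : Algebra.Smooth K B₀ := hφ
  have hprime : (RingHom.ker d.hom).IsPrime := RingHom.ker_isPrime d.hom
  have : Algebra.IsSmoothAt K (RingHom.ker d.hom) :=
    .comp K B₀ (Localization.AtPrime (RingHom.ker d.hom))
  obtain ⟨g, hg, n, _, ht, _⟩ :=
    Algebra.IsSmoothAt.exists_isStandardEtale_mvPolynomial (R := K) (p := RingHom.ker d.hom)
  have hu : IsUnit (d.hom g) := isUnit_iff_ne_zero.2 hg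
  let δ₀ : Localization.Away g →+* F := IsLocalization.Away.lift g hu
  have hδ₀ : δ₀.comp (algebraMap B₀ _) = d.hom := IsLocalization.Away.lift_comp g hu
  let δ : Localization.Away g →ₐ[K] F := ⟨δ₀, fun r => by
    change δ₀ (algebraMap K (Localization.Away g) r) = _
    rw [IsScalarTower.algebraMap_apply K B₀]
    exact congr($hδ₀ (φ.hom r)).trans congr($(hd).hom r)⟩
  refine ⟨n, Localization.Away g, inferInstance, inferInstance, inferInstance,
    Spec.map (CommRingCat.ofHom (algebraMap B₀ (Localization.Away g))) ≫ i, δ, ht,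
    inferInstance, ?_, ?_⟩
  · rw [Category.assoc, hi, Category.comp_id, ← Spec.map_comp]
    rfl
  · rw [← hdi, ← Spec.map_comp_assoc]
    congr 2
    exact CommRingCat.hom_ext hδ₀

open scoped MonObj

attribute [local instance] Algebra.TensorProduct.rightAlgebra in
/-- A smooth homomorphism of algebraic groups which is surjective on points over a separably closed
dense subfield of a Henselian valued field is surjective on points over the latter. -/
theorem surjective_rationalPoints_of_denseRange {K L F : Type u} [Field K] [Field L] [Field F]
    {Γ₀ : Type*} [LinearOrderedCommGroupWithZero Γ₀] [Valued F Γ₀]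
    [HenselianLocalRing (Valued.v (R := F)).valuationSubring]
    [Algebra K L] [Algebra L F] [Algebra K F] [IsScalarTower K L F]
    (hd : DenseRange (algebraMap L F))
    (hsep : ∀ x : F, IsSeparable L x → x ∈ (algebraMap L F).range)
    {G H : Over (Spec (.of K))} [GrpObj G] [GrpObj H] (f : G ⟶ H) [IsMonHom f] [Smooth f.left]
    [Smooth H.hom] (hL : Function.Surjective (RationalPoints.map f (algebraMap K L))) :
    Function.Surjective (RationalPoints.map f (algebraMap K F)) := by
  intro (h : Over.mk (Spec.map (CommRingCat.ofHom (algebraMap K F))) ⟶ H)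
  obtain ⟨n, B, _, _, _, i, δ, _, _, hi, hδ⟩ :=
    Smooth.exists_etale_mvPolynomial_of_point H.hom h.left (Over.w h)
  let C := TensorProduct K F B
  let res : Over.mk (Spec.map (CommRingCat.ofHom (algebraMap K F))) ⟶
      Over.mk (Spec.map (CommRingCat.ofHom (algebraMap K L))) :=
    Over.homMk (Spec.map (CommRingCat.ofHom (algebraMap L F))) (by
      change Spec.map _ ≫ Spec.map _ = Spec.map _
      rw [← Spec.map_comp, ← CommRingCat.ofHom_comp, ← IsScalarTower.algebraMap_eq])
  let pt (c : C →+* F) (hc : c.comp (algebraMap K C) = algebraMap K F) :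
      Over.mk (Spec.map (CommRingCat.ofHom (algebraMap K F))) ⟶
      Over.mk (Spec.map (CommRingCat.ofHom (algebraMap K C))) :=
    Over.homMk (Spec.map (CommRingCat.ofHom c)) (by
      change Spec.map _ ≫ Spec.map _ = Spec.map _
      rw [← Spec.map_comp, ← CommRingCat.ofHom_comp, hc])
  let qF : Over.mk (Spec.map (CommRingCat.ofHom (algebraMap K C))) ⟶ H :=
    Over.homMk (Spec.map (CommRingCat.ofHom (algebraMap F C)) ≫ h.left) (by
      rw [Category.assoc, Over.w h]
      change Spec.map _ ≫ Spec.map _ = Spec.map _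
      rw [← Spec.map_comp, ← CommRingCat.ofHom_comp, ← IsScalarTower.algebraMap_eq])
  let qB : Over.mk (Spec.map (CommRingCat.ofHom (algebraMap K C))) ⟶ H :=
    Over.homMk (Spec.map (CommRingCat.ofHom (algebraMap B C)) ≫ i) (by
      rw [Category.assoc, hi]
      change Spec.map _ ≫ Spec.map _ = Spec.map _
      rw [← Spec.map_comp, ← CommRingCat.ofHom_comp, ← IsScalarTower.algebraMap_eq])
  have hqF (c hc) (hcF : c.comp (algebraMap F C) = RingHom.id F) : pt c hc ≫ qF = h := by
    ext1
    change Spec.map _ ≫ Spec.map _ ≫ h.left = _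
    rw [← Spec.map_comp_assoc, ← CommRingCat.ofHom_comp, hcF, CommRingCat.ofHom_id, Spec.map_id,
      Category.id_comp]
  -- Over `Spec C`, `qB` is the universal point of the chart and `qF` is the constant point `h`.
  -- Their quotient is trivial at `c₀`, the point of the chart given by `h`, and there it lifts to
  -- the identity of `G`.
  let r := qB⁻¹ * qF
  let c₀ : C →ₐ[K] F := Algebra.TensorProduct.lift (AlgHom.id K F) δ fun _ _ => .all _ _
  have hc₀ : c₀.toRingHom.comp (algebraMap K C) = algebraMap K F := c₀.comp_algebraMap
  have hc₀F : c₀.toRingHom.comp (algebraMap F C) = RingHom.id F := by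
    ext x
    refine (Algebra.TensorProduct.lift_tmul (AlgHom.id K F) δ (fun _ _ => .all _ _) x (1 : B)).trans ?_
    rw [map_one, mul_one]
    rfl
  have hc₀B : c₀.toRingHom.comp (algebraMap B C) = δ.toRingHom := by
    ext x
    refine (Algebra.TensorProduct.lift_tmul (AlgHom.id K F) δ (fun _ _ => .all _ _) (1 : F) x).trans ?_
    rw [map_one, one_mul]
    rfl
  have hr₀ : (1 : Over.mk (Spec.map (CommRingCat.ofHom (algebraMap K F))) ⟶ G) ≫ f =
      pt c₀.toRingHom hc₀ ≫ r := by
    have h1 : pt c₀.toRingHom hc₀ ≫ qB = h := by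
      ext1
      change Spec.map _ ≫ Spec.map _ ≫ i = _
      rw [← Spec.map_comp_assoc, ← CommRingCat.ofHom_comp, hc₀B, hδ]
    rw [MonObj.one_comp, MonObj.comp_mul, GrpObj.comp_inv, h1, hqF _ hc₀ hc₀F, inv_mul_cancel]
  obtain ⟨D, φ, j, d, hφ, hj, hdc, -⟩ := Smooth.exists_Spec_of_point f.left r.left
    (1 : Over.mk (Spec.map (CommRingCat.ofHom (algebraMap K F))) ⟶ G).left
    (CommRingCat.ofHom c₀.toRingHom) congr(($hr₀).left)
  let _ : Algebra C D := φ.hom.toAlgebra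
  have : Algebra.Smooth C D := hφ
  have hdc' : d.hom.comp (algebraMap C D) = c₀.toRingHom := congrArg CommRingCat.Hom.hom hdc
  -- The lift at `c₀` deforms to a lift of `r` at a point `c` whose image in the chart is
  -- `L`-rational.
  obtain ⟨z, hzF, hzB⟩ := exists_ringHom_forall_mem_range K n (B := B) (C := C) (D := D) hd hsep
    d.hom (by rw [← RingHom.comp_assoc, hdc', hc₀F])
  let c := z.comp (algebraMap C D)
  have hcF : c.comp (algebraMap F C) = RingHom.id F := hzF
  have hc : c.comp (algebraMap K C) = algebraMap K F := by
    rw [IsScalarTower.algebraMap_eq K F C, ← RingHom.comp_assoc, hcF, RingHom.id_comp]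
  let g₁ : Over.mk (Spec.map (CommRingCat.ofHom (algebraMap K F))) ⟶ G :=
    Over.homMk (Spec.map (CommRingCat.ofHom z) ≫ j) (by
      rw [Category.assoc, ← Over.w f, reassoc_of% hj, Over.w r]
      change Spec.map _ ≫ Spec.map _ ≫ Spec.map _ = Spec.map _
      rw [← Spec.map_comp, ← Spec.map_comp, ← hc]
      rfl)
  have hg₁ : g₁ ≫ f = pt c hc ≫ r := by
    ext1
    change (Spec.map _ ≫ j) ≫ f.left = Spec.map _ ≫ r.left
    rw [Category.assoc, hj, ← Spec.map_comp_assoc]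
    rfl
  let e := RingEquiv.ofBijective (algebraMap L F).rangeRestrict
    ⟨(algebraMap L F).rangeRestrict.injective,
      (algebraMap L F).rangeRestrict_surjective⟩
  let β : B →+* L := e.symm.toRingHom.comp ((c.comp (algebraMap B C)).codRestrict _ hzB)
  have hβ : (algebraMap L F).comp β = c.comp (algebraMap B C) := by
    ext b
    exact congrArg Subtype.val (e.apply_symm_apply ⟨_, hzB b⟩)
  have hβK : β.comp (algebraMap K B) = algebraMap K L := by
    ext k
    apply (algebraMap L F).injective
    rw [← IsScalarTower.algebraMap_apply K L F, ← hc, IsScalarTower.algebraMap_eq K B C]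
    exact congr($hβ (algebraMap K B k))
  let x : Over.mk (Spec.map (CommRingCat.ofHom (algebraMap K L))) ⟶ H :=
    Over.homMk (Spec.map (CommRingCat.ofHom β) ≫ i) (by
      rw [Category.assoc, hi]
      change Spec.map _ ≫ Spec.map _ = Spec.map _
      rw [← Spec.map_comp, ← CommRingCat.ofHom_comp, hβK])
  have hx : pt c hc ≫ qB = res ≫ x := by
    ext1
    change Spec.map _ ≫ Spec.map _ ≫ i = Spec.map _ ≫ Spec.map _ ≫ i
    rw [← Spec.map_comp_assoc, ← Spec.map_comp_assoc, ← CommRingCat.ofHom_comp,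
      ← CommRingCat.ofHom_comp, hβ]
  obtain ⟨g₂, hg₂ : g₂ ≫ f = x⟩ := hL x
  -- `h = x * (x⁻¹ * h)`, where `g₂` lifts `x` and `g₁` lifts `x⁻¹ * h`, the value of `r` at `c`.
  refine ⟨(res ≫ g₂) * g₁, ?_⟩
  change ((res ≫ g₂) * g₁) ≫ f = h
  rw [MonObj.mul_comp, hg₁, Category.assoc, hg₂, MonObj.comp_mul, GrpObj.comp_inv, hx,
    mul_inv_cancel_left, hqF c hc hcF]

end CompletionPoints

/-! ### Finiteness of the exceptional set and conclusion -/

section Main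

theorem IsMaximalUnramifiedExtension.surjective_rationalPoints_completion {R K L : Type u}
    [CommRing R] [Field K] [Algebra R K] [IsDomain R] [IsDiscreteValuationRing R]
    [IsFractionRing R K] [Field L] [Algebra K L] {A : ValuationSubring L}
    (hA : IsMaximalUnramifiedExtension R K A) {G H : Over (Spec (.of K))} [GrpObj G] [GrpObj H]
    (f : G ⟶ H) [IsMonHom f] [Smooth f.left] [Smooth H.hom]
    (hL : Function.Surjective (RationalPoints.map f (algebraMap K L))) :
    Function.Surjective
      (RationalPoints.map f (A.toFieldCompletion.comp (algebraMap K L))) := by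
  have := hA.isDiscreteValuationRing
  have := A.henselianLocalRing_fieldCompletion
  let _ : Algebra L A.FieldCompletion := A.toFieldCompletion.toAlgebra
  let _ : Algebra K A.FieldCompletion := (A.toFieldCompletion.comp (algebraMap K L)).toAlgebra
  have : @IsScalarTower K L A.FieldCompletion _ Algebra.toSMul Algebra.toSMul :=
    .of_algebraMap_eq' rfl
  exact surjective_rationalPoints_of_denseRange (F := A.FieldCompletion)
    A.denseRange_toFieldCompletion hA.mem_range_of_isSeparable f hL

variable {S : Scheme.{u}} [IsDedekindScheme S] {G H : Over (Spec S.functionField)} [GrpObj H]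
  {N : Over S} [GrpObj N] {e : (genericFibre S).obj N ≅ H}

/-- The point extends to `Spec A`, with closed point over `s`. The whole `A`-point lifts along the
`q` through that closed point, and restricting the lift to `Spec L` gives the point of `G`. -/
theorem IsNeronModel.surjective_rationalPoints [LocallyOfFiniteType H.hom]
    (hN : IsNeronModel H N e) (f : G ⟶ H) {s : S} (hs : s ≠ genericPoint S)
    (hq : ∀ z : N.left, N.hom z = s → ∃ (Z : CommRingCat.{u}) (q : Spec Z ⟶ N.left), Smooth q ∧
      z ∈ Set.range q ∧ ∀ (T : CommRingCat.{u}) (t : Spec T ⟶ Spec Z) (h : Spec T ⟶ H.left),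
        t ≫ q = h ≫ IsNeronModel.fromGenericFibre e → ∃ g : Spec T ⟶ G.left, g ≫ f.left = h)
    {L : Type u} [Field L] [Algebra S.functionField L] {A : ValuationSubring L}
    (hA : IsMaximalUnramifiedExtension (S.presheaf.stalk s) S.functionField A) :
    Function.Surjective (RationalPoints.map f (algebraMap S.functionField L)) := by
  intro x
  have := IsDedekindScheme.isDiscreteValuationRing_stalk S hs
  obtain ⟨y, hy, hyx⟩ := hN.exists_point_of_isUnramifiedExtension hs
    hA.toIsUnramifiedExtension x.left (Over.w x)
  have hys : N.hom (y (IsLocalRing.closedPoint A)) = s := by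
    have := hA.extendsRing.isLocalHom_ringHom
    have h1 : Spec.map (CommRingCat.ofHom hA.extendsRing.ringHom) (IsLocalRing.closedPoint A) =
        IsLocalRing.closedPoint (S.presheaf.stalk s) :=
      IsLocalRing.comap_closedPoint hA.extendsRing.ringHom
    exact congr($hy (IsLocalRing.closedPoint A)).trans
      ((congrArg (S.fromSpecStalk s) h1).trans Scheme.fromSpecStalk_closedPoint)
  obtain ⟨Z, q, _, hz, hlift⟩ := hq _ hys
  obtain ⟨t, ht⟩ := hA.exists_lift_of_smooth q y hz
  obtain ⟨g, hg⟩ := hlift _ (Spec.map (CommRingCat.ofHom A.subtype) ≫ t) x.left (by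
    rw [Category.assoc, ht, hyx])
  refine ⟨Over.homMk g (by rw [← Over.w f, reassoc_of% hg, Over.w x]), ?_⟩
  ext1
  exact hg

/-- Away from the image of a proper closed subset of a Néron model of `H`, the integral points of the
Néron model lift along smooth morphisms which factor generically through `f`. -/
theorem IsNeronModel.finite_setOf_not_lift (hN : IsNeronModel H N e) (f : G ⟶ H) [Smooth f.left]
    [Surjective f.left] :
    {s : S | ¬ (s ≠ genericPoint S ∧ ∀ z : N.left, N.hom z = s →
      ∃ (Z : CommRingCat.{u}) (q : Spec Z ⟶ N.left), Smooth q ∧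
      z ∈ Set.range q ∧ ∀ (T : CommRingCat.{u}) (t : Spec T ⟶ Spec Z) (h : Spec T ⟶ H.left),
        t ≫ q = h ≫ IsNeronModel.fromGenericFibre e →
          ∃ g : Spec T ⟶ G.left, g ≫ f.left = h)}.Finite := by
  have := hN.smooth
  have := hN.quasiCompact
  have : IsNoetherian N.left :=
    { LocallyOfFiniteType.isLocallyNoetherian N.hom with
      toCompactSpace := QuasiCompact.compactSpace_of_compactSpace N.hom }
  have hj := IsNeronModel.isPullback_fromGenericFibre e
  choose Z q hq hmem hlift using Smooth.exists_spreading_out N.hom H.hom _ hj f.left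
  let W : Set N.left := ⋃ y, Set.range (q y)
  have hW : IsOpen W := isOpen_iUnion fun y => (q y).isOpenMap.isOpen_range
  have hη (x : N.left) (hx : N.hom x = genericPoint S) : x ∈ W := by
    obtain ⟨z, hz⟩ : genericPoint S ∈ Set.range (S.fromSpecStalk (genericPoint S)) :=
      ⟨_, Scheme.fromSpecStalk_closedPoint⟩
    obtain ⟨w, hw, -⟩ := Scheme.Pullback.exists_preimage_pullback (f := N.hom) x z (hx.trans hz.symm)
    refine Set.mem_iUnion.2 ⟨hj.isoPullback.inv w, ?_⟩
    have h1 := hmem (hj.isoPullback.inv w)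
    rwa [← Scheme.Hom.comp_apply, hj.isoPullback_inv_fst, hw] at h1
  have hfin := TopologicalSpace.NoetherianSpace.finite_image_compl N.hom.continuous hW
    fun x hx => IsDedekindScheme.isClosed_singleton S fun h => hx (hη x h)
  -- The generic point is discarded as well: it is itself closed when `S` is a single point, and its
  -- local ring is not a discrete valuation ring.
  refine (hfin.union (Set.finite_singleton (genericPoint S))).subset fun s hs => ?_
  by_contra hs'
  rw [Set.mem_union, not_or] at hs'
  refine hs ⟨hs'.2, fun z hz => ?_⟩
  obtain ⟨y, hy⟩ := Set.mem_iUnion.1 (not_not.1 fun h : z ∉ W => hs'.1 ⟨z, h, hz⟩)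
  exact ⟨Z y, q y, hq y, hy, hlift y⟩

end Main

theorem mainTheorem9 (S : Scheme.{u}) [IsDedekindScheme S]
    (G H : Over (Spec S.functionField)) [GrpObj G] [GrpObj H]
    [IsAlgebraicGroup G] [IsAlgebraicGroup H]
    (f : G ⟶ H) [IsMonHom f] [Smooth f.left] [Surjective f.left]
    (hH : HasNeronModel H) :
    {s : S | IsClosed {s} ∧
      ¬ ∀ (L : Type u) [Field L] [Algebra S.functionField L] (A : ValuationSubring L),
        IsMaximalUnramifiedExtension (S.presheaf.stalk s) S.functionField A →
          Function.Surjective (RationalPoints.map f (algebraMap S.functionField L)) ∧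
          Function.Surjective (RationalPoints.map f
            (A.toFieldCompletion.comp (algebraMap S.functionField L)))}.Finite := by
  obtain ⟨N, _, e, hN⟩ := hH
  have := hN.smooth
  have : LocallyOfFiniteType H.hom := IsAlgebraicGroup.locallyOfFiniteType
  -- Smoothness of `H` is inherited from the Néron model, whose generic fibre it is; the
  -- approximation over the completion depends on it.
  have : Smooth H.hom :=
    MorphismProperty.of_isPullback (P := @Smooth) (IsNeronModel.isPullback_fromGenericFibre e) hN.smooth
  refine (hN.finite_setOf_not_lift f).subset ?_
  rintro s ⟨-, hs⟩ ⟨hsη, hq⟩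
  refine hs fun L _ _ A hA => ?_
  have := IsDedekindScheme.isDiscreteValuationRing_stalk S hsη
  have hL := hN.surjective_rationalPoints f hsη hq hA
  exact ⟨hL, hA.surjective_rationalPoints_completion (K := S.functionField) f hL⟩
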